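/- **Setting.** *Stable models.* Rules $F\leftarrow G$ ($F,G$ propositional formulas) are read as implications, and an interpretation is the set of its true atoms; $X$ is a stable model of a set of formulas if $X$ satisfies it and no proper subset of $X$ satisfies its reduct with respect to $X$ (every maximal subformula not satisfied by $X$ is replaced by $\bot$). An $\mathrm{LP}^{\mathrm{MLN}}$ program $\Pi$ is a finite set of rules weighted by reals (soft) or by $\alpha$ (hard). $\mathrm{SM}[\Pi]$ is the set of interpretations $I$ that satisfy all hard rules and are stable models of the set of rules of $\Pi$ satisfied by $I$; these are what "stable model of $\Pi$" means below. $W_\Pi(I)$ is $\exp$ of the sum of the weights of the soft rules satisfied by $I$ if $I\in\mathrm{SM}[\Pi]$, and $0$ otherwise; $P_\Pi(I)=W_\Pi(I)/\sum_{J\in \mathrm{SM}[\Pi]}W_\Pi(J)$, and $P_\Pi(A)=\sum_{I\models A}P_\Pi(I)$ for a formula $A$. The utility $U_\Pi(I)$ is the sum of $u$ over all atoms $\mathtt{utility}(u,\mathbf t)\in I$, and $E[U_\Pi(A)]=\sum_{I\models A}U_\Pi(I)\,P_\Pi(I\mid A)$. *Action descriptions.* Let $D$ be a $p\mathcal{BC}+$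 action description with utility over finitely many constants with finite domains: fluent constants (regular or statically determined), Boolean action constants, pf constants, and initpf constants; every pf and initpf constant $c$ has a declared distribution $\{v_1:p_1,\dots,v_n:p_n\}$ on its domain with $0<p_j<1$ and $\sum_j p_j=1$. For $m\ge 0$, the program $D_m$ consists of: $i:F\leftarrow i:G$ for each static law **caused** $F$ **if** $G$ ($F,G$ fluent formulas) and $0\le i\le m$; $i{+}1:F\leftarrow (i{+}1:G)\wedge(i:H)$ for each dynamic law **caused** $F$ **if** $G$ **after** $H$ ($F$ with regular fluent constants only, $G$ a fluent formula, $H$ without initpf constants) and $0\le i<m$; the choice rules $0:c=v\leftarrow\neg\neg(0:c=v)$ for regular fluents $c$, and $i:c=v\leftarrow\neg\neg(i:c=v)$ for action constants $c$ and $0\le i<m$; the soft facts $\ln p_j:\,(i:c=v_j)$ for pf constants $c$ and $0\le i<m$; constraints saying that every fluent constant (at times $0,\dots,m$) and every action and pf constant (at times $0,\dots,m-1$) has exactly one value; and $\mathtt{utility}(v,i{+}1,id)\leftarrow(i{+}1:F)\wedge(i:G)$ for each utility law **reward** $v$ **if** $F$ **after** $G$ ($F$ with fluent, $G$ with fluent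 and action constants only) and $0\le i<m$, where $id$ is a number unique to the ground rule. All these rules except the soft facts are hard. $D_{init}$ consists of the hard rules $\bot\leftarrow\neg(0:F)\wedge(0:G)$ for the initial laws **initially** $F$ **if** $G$ ($F$ with fluent constants only, $G$ without action and pf constants), the soft facts $\ln p_j:(0:c=v_j)$ for the initpf constants $c$, and the hard constraints that every fluent and initpf constant has exactly one value at time $0$. $Tr(D,m)=D_{init}\cup D_m$. A *state* is an assignment $s$ to the fluent constants such that $0:s$ extends to a stable model of $D_0$; $\mathbf S$ is the set of states. $\mathbf A$ is the set of assignments $a$ to the action constants such that $0:a$ extends to a stable model of $D_1$. $\langle s,e,s'\rangle$ is a *transition* if $0:s\cup 0:e\cup 1:s'$ extends to a stable model of $D_1$, and $(\langle s,e,s'\rangle,pf)$ is a *pf-transition* if $0:s\cup 0:e\cup 1:s'\cup 0:pf$, together with the utility atoms it determines, is a stable model of $D_1$. A state $s$ is *consistent with $D_{init}$* if some stable model of $D_{init}\cup D_0$ satisfies $0:s$. We also write $i:s$ and $i:a$ for the conjunctions of the corresponding timestamped atoms. *Assumptions.* (1) If $\langle s,e,s'\rangle$ is a transition, then $e$ makes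 at most one action constant true. (2) For every state $s$, every assignment $e$ to the action constants that makes at most one of them true, and every assignment $pf$ to the pf constants, there is exactly one state $s'$ such that $(\langle s,e,s'\rangle,pf)$ is a pf-transition. (3) For every assignment $pf_{init}$ to the initpf constants there is exactly one assignment $fl$ to the fluent constants such that $0:pf_{init}\cup 0:fl$ is a stable model of $D_{init}\cup D_0$. *The MDP $M(D)$* has state set $\mathbf S$, action set $\mathbf A$, transition probabilities $T(s,a,s')=P_{D_1}(1:s'\mid 0:s\wedge 0:a)$ and rewards $R(s,a,s')=E[U_{D_1}(0:s\wedge 0:a\wedge 1:s')]$. For a history put $R_{M(D)}(\langle s_0,a_0,\dots,a_{m-1},s_m\rangle)=\sum_{i<m}R(s_i,a_i,s_{i+1})$ and $P_{M(D)}(\langle s_0,a_0,\dots,a_{m-1},s_m\rangle)=\prod_{i<m}T(s_i,a_i,s_{i+1})$. Let $\langle s_0,\dots,s_m\rangle^t=\bigwedge_{i\le m} i:s_i$, $\langle s_0,a_0,\dots,a_{m-1},s_m\rangle^t=\bigwedge_{i\le m} i:s_i\wedge\bigwedge_{i<m}i:a_i$, and $R_D(\langle s_0,a_0,\dots,s_m\rangle)=E[U_{Tr(D,m)}(\langle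 s_0,a_0,\dots,s_m\rangle^t)]$. For a non-stationary policy $\pi:\mathbf S\times\{0,\dots,m-1\}\to\mathbf A$ let $C_{\pi,m}=\bigwedge_{s\in\mathbf S,\,0\le i<m}(i:s\rightarrow i:\pi(s,i))$. **Theorem.** Suppose $D$ satisfies Assumptions (1)–(3). Let $m\ge 0$, let $\pi$ be a non-stationary policy, and let $s_0,\dots,s_m\in\mathbf S$ be states such that $s_0$ is consistent with $D_{init}$. Write $h=\langle s_0,\pi(s_0,0),s_1,\dots,\pi(s_{m-1},m-1),s_m\rangle$. Then - if at least one stable model of $Tr(D,m)$ satisfies $h^t$ (so that $R_D(h)$ is defined), then $R_D(h)=R_{M(D)}(h)$; - $P_{Tr(D,m)}\big(\langle s_0,\dots,s_m\rangle^t\mid 0:s_0\wedge C_{\pi,m}\big)=P_{M(D)}(h)$. -/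

import Mathlib

universe u

/-! ### Propositional formulas and the stable model semantics -/

/-- Propositional formulas over a type `α` of atoms. -/
inductive PForm (α : Type u) : Type u
  | atom (a : α)
  | bot
  | and (F G : PForm α)
  | or (F G : PForm α)
  | imp (F G : PForm α)

namespace PForm

variable {α β : Type u}

/-- Negation, as the usual abbreviation. -/
def neg (F : PForm α) : PForm α := imp F bot

/-- Truth, as the usual abbreviation. -/
def top : PForm α := imp bot bot

/-- Renaming of atoms. -/
def map (f : α → β) : PForm α → PForm β
  | atom a => atom (f a)
  | bot => bot
  | and F G => and (map f F) (map f G)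
  | or F G => or (map f F) (map f G)
  | imp F G => imp (map f F) (map f G)

/-- The atoms that occur in a formula. -/
def atoms : PForm α → List α
  | atom a => [a]
  | bot => []
  | and F G => atoms F ++ atoms G
  | or F G => atoms F ++ atoms G
  | imp F G => atoms F ++ atoms G

/-- Classical satisfaction; an interpretation is the finite set of the atoms that are true. -/
def Sat (I : Finset α) : PForm α → Prop
  | atom a => a ∈ I
  | bot => False
  | and F G => Sat I F ∧ Sat I G
  | or F G => Sat I F ∨ Sat I G
  | imp F G => Sat I F → Sat I G

/-- The conjunction of a finite family of formulas. -/
noncomputable def bigAnd {ι : Type*} [Fintype ι] (f : ι → PForm α) : PForm α :=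
  ((Finset.univ : Finset ι).toList.map f).foldr and top

/-- The disjunction of a finite family of formulas. -/
noncomputable def bigOr {ι : Type*} [Fintype ι] (f : ι → PForm α) : PForm α :=
  ((Finset.univ : Finset ι).toList.map f).foldr or bot

theorem sat_bigAnd {ι : Type*} [Fintype ι] (f : ι → PForm α) (I : Finset α) :
    Sat I (bigAnd f) ↔ ∀ i, Sat I (f i) := by
  have h : ∀ l : List ι, Sat I ((l.map f).foldr and top) ↔ ∀ i ∈ l, Sat I (f i) := by
    intro l
    induction l with
    | nil => simp [Sat, top]
    | cons a l ih => simp [Sat, ih]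
  simpa [bigAnd] using h Finset.univ.toList

theorem sat_bigOr {ι : Type*} [Fintype ι] (f : ι → PForm α) (I : Finset α) :
    Sat I (bigOr f) ↔ ∃ i, Sat I (f i) := by
  have h : ∀ l : List ι, Sat I ((l.map f).foldr or bot) ↔ ∃ i ∈ l, Sat I (f i) := by
    intro l
    induction l with
    | nil => simp [Sat]
    | cons a l ih => simp [Sat, ih]
  simpa [bigOr] using h Finset.univ.toList

open Classical in
/-- The reduct of a formula relative to `X`: every maximal subformula that `X` does not satisfy
is replaced by `⊥`. -/
noncomputable def reduct (X : Finset α) : PForm α → PForm α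
  | atom a => if a ∈ X then atom a else bot
  | bot => bot
  | and F G => if Sat X (and F G) then and (reduct X F) (reduct X G) else bot
  | or F G => if Sat X (or F G) then or (reduct X F) (reduct X G) else bot
  | imp F G => if Sat X (imp F G) then imp (reduct X F) (reduct X G) else bot

/-- `X` is a stable model of a set `Γ` of formulas: it satisfies `Γ`, and no proper subset of `X`
satisfies the reduct of `Γ` relative to `X`. -/
def IsStableModel (X : Finset α) (Γ : Set (PForm α)) : Prop :=
  (∀ F ∈ Γ, Sat X F) ∧ ∀ Y : Finset α, Y ⊂ X → ¬ ∀ F ∈ Γ, Sat Y (reduct X F)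

theorem sat_congr {X Y : Finset α} : ∀ (F : PForm α),
    (∀ a ∈ F.atoms, (a ∈ X ↔ a ∈ Y)) → (Sat X F ↔ Sat Y F)
  | atom a, h => h a (by simp [atoms])
  | bot, _ => Iff.rfl
  | and F G, h => and_congr (sat_congr F fun a ha => h a (by simp [atoms, ha]))
      (sat_congr G fun a ha => h a (by simp [atoms, ha]))
  | or F G, h => or_congr (sat_congr F fun a ha => h a (by simp [atoms, ha]))
      (sat_congr G fun a ha => h a (by simp [atoms, ha]))
  | imp F G, h => imp_congr (sat_congr F fun a ha => h a (by simp [atoms, ha]))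
      (sat_congr G fun a ha => h a (by simp [atoms, ha]))

theorem atoms_reduct (X : Finset α) : ∀ (F : PForm α), ∀ a ∈ (reduct X F).atoms, a ∈ F.atoms := by
  intro F
  induction F with
  | atom b => intro a; unfold reduct; split_ifs <;> simp [atoms]
  | bot => intro a; simp [reduct]
  | and F G ihF ihG | or F G ihF ihG | imp F G ihF ihG =>
    intro a
    unfold reduct
    split_ifs
    · simp only [atoms, List.mem_append]
      exact Or.imp (ihF a) (ihG a)
    · simp [atoms]

theorem sat_reduct_self (X : Finset α) : ∀ (F : PForm α), Sat X (reduct X F) ↔ Sat X F := by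
  intro F
  induction F with
  | atom b => unfold reduct; split_ifs with h <;> simp [Sat, h]
  | bot => simp [reduct]
  | and F G ihF ihG | or F G ihF ihG | imp F G ihF ihG =>
    unfold reduct
    split_ifs with h
    · simp only [Sat, ihF, ihG]
    · simp only [Sat] at h ⊢
      tauto

/-- A stable model contains only atoms that occur in the formulas. -/
theorem IsStableModel.mem_atoms {X : Finset α} {Γ : Set (PForm α)} (h : IsStableModel X Γ)
    {a : α} (ha : a ∈ X) : ∃ F ∈ Γ, a ∈ F.atoms := by
  classical
  by_contra hne
  push Not at hne
  refine h.2 (X.erase a) (Finset.erase_ssubset ha) fun F hF => ?_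
  refine (sat_congr _ fun b hb => ?_).1 ((sat_reduct_self X F).2 (h.1 F hF))
  have hba : b ≠ a := fun e => hne F hF (e ▸ atoms_reduct X F b hb)
  simp [hba]

end PForm

/-! ### `LP^MLN` programs -/

/-- The weight of a rule: infinite (`hard`) or a real number (`soft w`). -/
inductive RuleWeight : Type
  | hard
  | soft (w : ℝ)

/-- The numerical contribution of a weight (the infinite weights of the hard rules, which all
the models in question satisfy, cancel out). -/
def RuleWeight.val : RuleWeight → ℝ
  | hard => 0
  | soft w => w

/-- A rule `head ← body`. -/
structure LPRule (α : Type u) : Type u where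
  head : PForm α
  body : PForm α

/-- A rule as a formula. -/
def LPRule.toForm {α : Type u} (r : LPRule α) : PForm α := PForm.imp r.body r.head

/-- A weighted rule `w : R`. -/
structure WRule (α : Type u) : Type u where
  weight : RuleWeight
  rule : LPRule α

/-- The hard rule `α : head ← body`. -/
def hardRule {α : Type u} (head body : PForm α) : WRule α := ⟨.hard, ⟨head, body⟩⟩

/-- The soft fact `w : A`. -/
def softFact {α : Type u} (w : ℝ) (a : α) : WRule α := ⟨.soft w, ⟨.atom a, .top⟩⟩

/-- The hard choice rule `{A}^ch`, that is, `A ← ¬¬A`. -/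
def choiceRule {α : Type u} (a : α) : WRule α :=
  hardRule (.atom a) (.neg (.neg (.atom a)))

/-- An `LP^MLN` program: a finite set of weighted rules. -/
abbrev LPMLN (α : Type u) : Type u := Finset (WRule α)

namespace LPMLN

variable {α : Type u}

/-- `SM[Π]`: the interpretations `I` that are stable models of `Π_I`, the set of the rules of `Π`
that `I` satisfies, and that satisfy all hard rules of `Π`. -/
def SM (P : LPMLN α) : Set (Finset α) :=
  {I | PForm.IsStableModel I {F | ∃ r ∈ P, r.rule.toForm = F ∧ PForm.Sat I F} ∧
    ∀ r ∈ P, r.weight = .hard → PForm.Sat I r.rule.toForm}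

theorem finite_SM (P : LPMLN α) : P.SM.Finite := by
  classical
  refine (Finset.finite_toSet
    (P.biUnion fun r => r.rule.toForm.atoms.toFinset).powerset).subset fun I hI => ?_
  simp only [Finset.coe_powerset, Set.mem_preimage, Set.mem_powerset_iff, Finset.coe_subset]
  intro a ha
  obtain ⟨F, ⟨r, hr, rfl, -⟩, haF⟩ := hI.1.mem_atoms ha
  exact Finset.mem_biUnion.2 ⟨r, hr, by simpa using haF⟩

/-- `SM[Π]` as a finite set. -/
noncomputable def models (P : LPMLN α) : Finset (Finset α) := P.finite_SM.toFinset

open Classical in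
/-- The weight of an interpretation. -/
noncomputable def weight (P : LPMLN α) (I : Finset α) : ℝ :=
  if I ∈ P.SM then
    Real.exp (∑ r ∈ P with PForm.Sat I r.rule.toForm, r.weight.val)
  else 0

/-- The probability of an interpretation. -/
noncomputable def prob (P : LPMLN α) (I : Finset α) : ℝ :=
  P.weight I / ∑ J ∈ P.models, P.weight J

open Classical in
/-- The probability of a proposition. -/
noncomputable def probOf (P : LPMLN α) (A : PForm α) : ℝ :=
  ∑ I ∈ P.models with PForm.Sat I A, P.prob I

/-- The conditional probability of a proposition `A` given a proposition `B`. -/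
noncomputable def condProb (P : LPMLN α) (A B : PForm α) : ℝ :=
  P.probOf (.and A B) / P.probOf B

open Classical in
/-- The conditional probability of an interpretation `I` given a proposition `B`. -/
noncomputable def condProbInterp (P : LPMLN α) (I : Finset α) (B : PForm α) : ℝ :=
  (if PForm.Sat I B then P.prob I else 0) / P.probOf B

theorem weight_nonneg (P : LPMLN α) (I : Finset α) : 0 ≤ P.weight I := by
  unfold weight
  split_ifs
  · exact (Real.exp_pos _).le
  · exact le_rfl

theorem prob_nonneg (P : LPMLN α) (I : Finset α) : 0 ≤ P.prob I :=
  div_nonneg (P.weight_nonneg I) (Finset.sum_nonneg fun J _ => P.weight_nonneg J)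

theorem probOf_nonneg (P : LPMLN α) (A : PForm α) : 0 ≤ P.probOf A :=
  Finset.sum_nonneg fun I _ => P.prob_nonneg I

theorem condProb_mem_Icc (P : LPMLN α) (A B : PForm α) : P.condProb A B ∈ Set.Icc (0 : ℝ) 1 := by
  classical
  refine ⟨div_nonneg (P.probOf_nonneg _) (P.probOf_nonneg _),
    div_le_one_of_le₀ ?_ (P.probOf_nonneg _)⟩
  refine Finset.sum_le_sum_of_subset_of_nonneg ?_ fun I _ _ => P.prob_nonneg I
  intro I hI
  simp only [Finset.mem_filter] at hI ⊢
  exact ⟨hI.1, hI.2.2⟩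

end LPMLN

/-! ### Utility atoms and expected utility -/

/-- Atoms of a signature `α` extended by the atoms `utility(u, t)`, where `u` is a real number and
`t` is a list of terms (numbers). -/
inductive UAtom (α : Type u) : Type u
  | base (a : α)
  | utility (v : ℝ) (t : List ℕ)

/-- The contribution of an atom to the utility of an interpretation. -/
def UAtom.util {α : Type u} : UAtom α → ℝ
  | base _ => 0
  | utility v _ => v

/-- The utility of an interpretation: the sum of `u` over the atoms `utility(u, t)` in it. -/
noncomputable def utilityOf {α : Type u} (I : Finset (UAtom α)) : ℝ := ∑ a ∈ I, a.util

open Classical in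
/-- The expected utility `E[U_Π(A)]` of a proposition `A`. -/
noncomputable def expUtility {α : Type u} (P : LPMLN (UAtom α)) (A : PForm (UAtom α)) : ℝ :=
  ∑ I ∈ P.models with PForm.Sat I A, utilityOf I * P.condProbInterp I A

/-! ### Multi-valued signatures and `pBC+` action descriptions -/

/-- The constants of a `pBC+` action description with their finite domains. The action constants
are Boolean. A fluent constant that is not regular is statically determined. -/
structure PBCSignature : Type (u + 1) where
  Fluent : Type u
  Action : Type u
  Pf : Type u
  InitPf : Type u
  Regular : Fluent → Prop
  flDom : Fluent → Type u
  pfDom : Pf → Type u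
  initDom : InitPf → Type u
  [fintypeFluent : Fintype Fluent]
  [fintypeAction : Fintype Action]
  [fintypePf : Fintype Pf]
  [fintypeInitPf : Fintype InitPf]
  [fintypeFlDom : ∀ c, Fintype (flDom c)]
  [fintypePfDom : ∀ c, Fintype (pfDom c)]
  [fintypeInitDom : ∀ c, Fintype (initDom c)]

attribute [instance] PBCSignature.fintypeFluent PBCSignature.fintypeAction
  PBCSignature.fintypePf PBCSignature.fintypeInitPf PBCSignature.fintypeFlDom
  PBCSignature.fintypePfDom PBCSignature.fintypeInitDom

namespace PBCSignature

/-- The atoms `c = v`. -/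
inductive Atom (S : PBCSignature.{u}) : Type u
  | fl (c : S.Fluent) (v : S.flDom c)
  | act (c : S.Action) (v : Bool)
  | pf (c : S.Pf) (v : S.pfDom c)
  | initpf (c : S.InitPf) (v : S.initDom c)

variable {S : PBCSignature.{u}}

def Atom.IsFluent : S.Atom → Prop
  | .fl _ _ => True
  | _ => False

def Atom.IsRegular : S.Atom → Prop
  | .fl c _ => S.Regular c
  | _ => False

def Atom.IsAction : S.Atom → Prop
  | .act _ _ => True
  | _ => False

def Atom.IsPf : S.Atom → Prop
  | .pf _ _ => True
  | _ => False

def Atom.IsInitPf : S.Atom → Prop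
  | .initpf _ _ => True
  | _ => False

/-- Interpretations of the fluent constants. -/
abbrev FlAssign (S : PBCSignature.{u}) : Type u := ∀ c : S.Fluent, S.flDom c

/-- Interpretations of the action constants. -/
abbrev ActAssign (S : PBCSignature.{u}) : Type u := S.Action → Bool

/-- Value assignments to the pf constants. -/
abbrev PfAssign (S : PBCSignature.{u}) : Type u := ∀ c : S.Pf, S.pfDom c

/-- Value assignments to the initpf constants. -/
abbrev InitAssign (S : PBCSignature.{u}) : Type u := ∀ c : S.InitPf, S.initDom c

/-- The atoms of the translation: timestamped atoms `i : c = v` and utility atoms. -/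
abbrev TAtom (S : PBCSignature.{u}) : Type u := UAtom (ℕ × S.Atom)

/-- The timestamped atom `i : c = v`. -/
def stamp (i : ℕ) (a : S.Atom) : S.TAtom := .base (i, a)

/-- `i : F`. -/
def stampForm (i : ℕ) (F : PForm S.Atom) : PForm S.TAtom := F.map (stamp i)

end PBCSignature

open PBCSignature

/-- The static law `caused F if G`. -/
structure StaticLaw (S : PBCSignature.{u}) : Type u where
  F : PForm S.Atom
  G : PForm S.Atom
  fluent_F : ∀ a ∈ F.atoms, a.IsFluent
  fluent_G : ∀ a ∈ G.atoms, a.IsFluent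

/-- The fluent dynamic law `caused F if G after H`. -/
structure DynamicLaw (S : PBCSignature.{u}) : Type u where
  F : PForm S.Atom
  G : PForm S.Atom
  H : PForm S.Atom
  /-- `F` is a fluent formula without statically determined constants. -/
  regular_F : ∀ a ∈ F.atoms, a.IsRegular
  fluent_G : ∀ a ∈ G.atoms, a.IsFluent
  no_initpf_H : ∀ a ∈ H.atoms, ¬ a.IsInitPf

/-- The initial static law `initially F if G`. -/
structure InitialLaw (S : PBCSignature.{u}) : Type u where
  F : PForm S.Atom
  G : PForm S.Atom
  fluent_F : ∀ a ∈ F.atoms, a.IsFluent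
  no_action_pf_G : ∀ a ∈ G.atoms, ¬ a.IsAction ∧ ¬ a.IsPf

/-- The utility law `reward v if F after G`. -/
structure UtilityLaw (S : PBCSignature.{u}) : Type u where
  v : ℝ
  F : PForm S.Atom
  G : PForm S.Atom
  fluent_F : ∀ a ∈ F.atoms, a.IsFluent
  fluent_action_G : ∀ a ∈ G.atoms, a.IsFluent ∨ a.IsAction

/-- A `pBC+` action description with utility. The declarations
`caused c = {v₁ : p₁, …, vₙ : pₙ}` of the pf and initpf constants, one for each constant,
are given by `pfProb` and `initProb`. The utility laws are listed, so that they are numbered. -/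
structure ActionDescription (S : PBCSignature.{u}) : Type u where
  staticLaws : Finset (StaticLaw S)
  dynamicLaws : Finset (DynamicLaw S)
  initialLaws : Finset (InitialLaw S)
  utilityLaws : List (UtilityLaw S)
  pfProb : ∀ c : S.Pf, S.pfDom c → ℝ
  pfProb_pos : ∀ c v, 0 < pfProb c v
  pfProb_lt_one : ∀ c v, pfProb c v < 1
  pfProb_sum : ∀ c, ∑ v, pfProb c v = 1
  initProb : ∀ c : S.InitPf, S.initDom c → ℝ
  initProb_pos : ∀ c v, 0 < initProb c v
  initProb_lt_one : ∀ c v, initProb c v < 1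
  initProb_sum : ∀ c, ∑ v, initProb c v = 1

open Classical in
/-- The uniqueness and existence of value constraints for a constant whose atoms are `f v`. -/
noncomputable def valueConstraints {α ι : Type u} [Fintype ι] (f : ι → α) : LPMLN α :=
  ((Finset.univ : Finset (ι × ι)).filter fun p => p.1 ≠ p.2).image
      (fun p => hardRule .bot (.and (.atom (f p.1)) (.atom (f p.2)))) ∪
    {hardRule .bot (.neg (PForm.bigOr fun v => .atom (f v)))}

/-- The constraints for a Boolean constant whose atoms are `f true` and `f false`. -/
noncomputable def boolConstraints {α : Type u} (f : Bool → α) : LPMLN α :=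
  valueConstraints fun b : ULift.{u} Bool => f b.down

namespace ActionDescription

variable {S : PBCSignature.{u}}

open Classical in
/-- The program `D_m`. -/
noncomputable def Dm (D : ActionDescription S) (m : ℕ) : LPMLN S.TAtom :=
  -- static laws
  (Finset.range (m + 1) ×ˢ D.staticLaws).image
      (fun p => hardRule (stampForm p.1 p.2.F) (stampForm p.1 p.2.G)) ∪
  -- fluent dynamic laws
  (Finset.range m ×ˢ D.dynamicLaws).image
      (fun p => hardRule (stampForm (p.1 + 1) p.2.F)
        (.and (stampForm (p.1 + 1) p.2.G) (stampForm p.1 p.2.H))) ∪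
  -- the initial values of the regular fluents are exogenous
  ((Finset.univ : Finset (Σ c : S.Fluent, S.flDom c)).filter fun x => S.Regular x.1).image
      (fun x => choiceRule (stamp 0 (.fl x.1 x.2))) ∪
  -- actions are exogenous
  (Finset.range m ×ˢ (Finset.univ : Finset (S.Action × Bool))).image
      (fun p => choiceRule (stamp p.1 (.act p.2.1 p.2.2))) ∪
  -- pf constant declarations
  (Finset.range m ×ˢ (Finset.univ : Finset (Σ c : S.Pf, S.pfDom c))).image
      (fun p => softFact (Real.log (D.pfProb p.2.1 p.2.2)) (stamp p.1 (.pf p.2.1 p.2.2))) ∪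
  -- every constant has exactly one value
  (Finset.range (m + 1) ×ˢ (Finset.univ : Finset S.Fluent)).biUnion
      (fun p => valueConstraints fun v => stamp p.1 (.fl p.2 v)) ∪
  (Finset.range m ×ˢ (Finset.univ : Finset S.Action)).biUnion
      (fun p => boolConstraints fun v => stamp p.1 (.act p.2 v)) ∪
  (Finset.range m ×ˢ (Finset.univ : Finset S.Pf)).biUnion
      (fun p => valueConstraints fun v => stamp p.1 (.pf p.2 v)) ∪
  -- utility laws; the number `Nat.pair i k` identifies the ground rule
  (Finset.range m ×ˢ (Finset.univ : Finset (Fin D.utilityLaws.length))).image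
      (fun p => hardRule
        (.atom (.utility (D.utilityLaws.get p.2).v [p.1 + 1, Nat.pair p.1 p.2]))
        (.and (stampForm (p.1 + 1) (D.utilityLaws.get p.2).F)
          (stampForm p.1 (D.utilityLaws.get p.2).G)))

open Classical in
/-- The program `D_init`. -/
noncomputable def Dinit (D : ActionDescription S) : LPMLN S.TAtom :=
  D.initialLaws.image
      (fun l => hardRule .bot (.and (.neg (stampForm 0 l.F)) (stampForm 0 l.G))) ∪
  (Finset.univ : Finset (Σ c : S.InitPf, S.initDom c)).image
      (fun x => softFact (Real.log (D.initProb x.1 x.2)) (stamp 0 (.initpf x.1 x.2))) ∪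
  (Finset.univ : Finset S.Fluent).biUnion
      (fun c => valueConstraints fun v => stamp 0 (.fl c v)) ∪
  (Finset.univ : Finset S.InitPf).biUnion
      (fun c => valueConstraints fun v => stamp 0 (.initpf c v))

open Classical in
/-- The program `Tr(D, m)`, the union of `D_init` and `D_m`. -/
noncomputable def Tr (D : ActionDescription S) (m : ℕ) : LPMLN S.TAtom := D.Dinit ∪ D.Dm m

end ActionDescription

/-! ### States, transitions and the standing assumptions -/

namespace PBCSignature

variable {S : PBCSignature.{u}}

/-- On the atoms `i : c = v` with `c` a fluent constant, `X` is `i : s`. -/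
def AgreesFl (X : Finset S.TAtom) (i : ℕ) (s : S.FlAssign) : Prop :=
  ∀ c v, stamp i (.fl c v) ∈ X ↔ s c = v

/-- On the atoms `i : c = v` with `c` an action constant, `X` is `i : e`. -/
def AgreesAct (X : Finset S.TAtom) (i : ℕ) (e : S.ActAssign) : Prop :=
  ∀ c v, stamp i (.act c v) ∈ X ↔ e c = v

/-- On the atoms `i : c = v` with `c` a pf constant, `X` is `i : f`. -/
def AgreesPf (X : Finset S.TAtom) (i : ℕ) (f : S.PfAssign) : Prop :=
  ∀ c v, stamp i (.pf c v) ∈ X ↔ f c = v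

/-- On the atoms `0 : c = v` with `c` an initpf constant, `X` is `0 : f`. -/
def AgreesInit (X : Finset S.TAtom) (f : S.InitAssign) : Prop :=
  ∀ c v, stamp 0 (.initpf c v) ∈ X ↔ f c = v

/-- The formula `i : s`. -/
noncomputable def flForm (i : ℕ) (s : S.FlAssign) : PForm S.TAtom :=
  PForm.bigAnd fun c => .atom (stamp i (.fl c (s c)))

/-- The formula `i : a`. -/
noncomputable def actForm (i : ℕ) (a : S.ActAssign) : PForm S.TAtom :=
  PForm.bigAnd fun c => .atom (stamp i (.act c (a c)))

/-- At most one action is executed. -/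
def AtMostOneAction (e : S.ActAssign) : Prop := ∀ a b, e a = true → e b = true → a = b

end PBCSignature

namespace ActionDescription

variable {S : PBCSignature.{u}}

/-- `s` is a state: `0 : s` is a residual stable model of `D_0`. -/
def IsState (D : ActionDescription S) (s : S.FlAssign) : Prop :=
  ∃ X ∈ (D.Dm 0).SM, AgreesFl X 0 s

/-- `0 : a` is a residual stable model of `D_1`. -/
def IsActionInterp (D : ActionDescription S) (a : S.ActAssign) : Prop :=
  ∃ X ∈ (D.Dm 1).SM, AgreesAct X 0 a

/-- `⟨s, e, s'⟩` is a transition. -/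
def IsTransition (D : ActionDescription S) (s : S.FlAssign) (e : S.ActAssign)
    (s' : S.FlAssign) : Prop :=
  ∃ X ∈ (D.Dm 1).SM, AgreesFl X 0 s ∧ AgreesAct X 0 e ∧ AgreesFl X 1 s'

/-- `(⟨s, e, s'⟩, f)` is a pf-transition. -/
def IsPfTransition (D : ActionDescription S) (s : S.FlAssign) (e : S.ActAssign)
    (s' : S.FlAssign) (f : S.PfAssign) : Prop :=
  ∃ X ∈ (D.Dm 1).SM, AgreesFl X 0 s ∧ AgreesAct X 0 e ∧ AgreesFl X 1 s' ∧ AgreesPf X 0 f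

/-- No concurrency. -/
def NoConcurrency (D : ActionDescription S) : Prop :=
  ∀ s e s', D.IsTransition s e s' → AtMostOneAction e

/-- Nondeterministic transitions are controlled by pf constants. -/
def TransitionsControlled (D : ActionDescription S) : Prop :=
  ∀ s, D.IsState s → ∀ e : S.ActAssign, AtMostOneAction e → ∀ f : S.PfAssign,
    ∃! s', D.IsState s' ∧ D.IsPfTransition s e s' f

/-- Nondeterminism on initial states is controlled by initpf constants. -/
def InitialStatesControlled (D : ActionDescription S) : Prop :=
  ∀ f : S.InitAssign, ∃! s : S.FlAssign,
    ∃ X ∈ (D.Tr 0).SM, AgreesInit X f ∧ AgreesFl X 0 s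

/-- `s` is consistent with the initial part of the description: some stable model of
`D_init ∪ D_0` satisfies `0 : s`. -/
def ConsistentInit (D : ActionDescription S) (s : S.FlAssign) : Prop :=
  ∃ X ∈ (D.Tr 0).SM, PForm.Sat X (flForm 0 s)

/-- The set of states. -/
abbrev States (D : ActionDescription S) : Type u := {s : S.FlAssign // D.IsState s}

/-- The set of actions. -/
abbrev Actions (D : ActionDescription S) : Type u := {a : S.ActAssign // D.IsActionInterp a}

noncomputable instance (D : ActionDescription S) : Fintype D.States := by
  classical
  exact Fintype.ofFinite _

/-- Non-stationary policies with horizon `m`. -/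
abbrev Policy (D : ActionDescription S) (m : ℕ) : Type u := D.States → Fin m → D.Actions

/-- The formula `⟨s₀, …, s_m⟩ᵗ`. -/
noncomputable def statesForm (D : ActionDescription S) {m : ℕ} (s : Fin (m + 1) → D.States) :
    PForm S.TAtom :=
  PForm.bigAnd fun i : Fin (m + 1) => flForm i (s i).1

/-- The formula `⟨s₀, a₀, s₁, …, a_{m-1}, s_m⟩ᵗ`. -/
noncomputable def historyForm (D : ActionDescription S) {m : ℕ} (s : Fin (m + 1) → D.States)
    (a : Fin m → D.Actions) : PForm S.TAtom :=
  .and (D.statesForm s) (PForm.bigAnd fun i : Fin m => actForm i (a i).1)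

/-- The formula `C_{π,m}`. -/
noncomputable def policyForm (D : ActionDescription S) {m : ℕ} (π : D.Policy m) :
    PForm S.TAtom :=
  PForm.bigAnd fun p : D.States × Fin m => .imp (flForm p.2 p.1.1) (actForm p.2 (π p.1 p.2).1)

/-- The total reward `R_D` of a history. -/
noncomputable def totalReward (D : ActionDescription S) {m : ℕ} (s : Fin (m + 1) → D.States)
    (a : Fin m → D.Actions) : ℝ :=
  expUtility (D.Tr m) (D.historyForm s a)

end ActionDescription

/-! ### Markov decision processes -/

/-- A Markov decision process. -/
structure MDP (State Act : Type u) : Type u where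
  T : State → Act → State → ℝ
  T_mem : ∀ s a s', T s a s' ∈ Set.Icc (0 : ℝ) 1
  R : State → Act → State → ℝ

namespace MDP

variable {State Act : Type u}

/-- The total reward of a history. -/
noncomputable def totalReward (M : MDP State Act) {m : ℕ} (s : Fin (m + 1) → State)
    (a : Fin m → Act) : ℝ :=
  ∑ i : Fin m, M.R (s i.castSucc) (a i) (s i.succ)

/-- The probability of a history. -/
noncomputable def historyProb (M : MDP State Act) {m : ℕ} (s : Fin (m + 1) → State)
    (a : Fin m → Act) : ℝ :=
  ∏ i : Fin m, M.T (s i.castSucc) (a i) (s i.succ)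

end MDP

/-- The Markov decision process `M(D)`. -/
noncomputable def ActionDescription.toMDP {S : PBCSignature.{u}} (D : ActionDescription S) :
    MDP D.States D.Actions where
  T s a s' := (D.Dm 1).condProb (flForm 1 s'.1) (.and (flForm 0 s.1) (actForm 0 a.1))
  T_mem _ _ _ := LPMLN.condProb_mem_Icc _ _ _
  R s a s' := expUtility (D.Dm 1)
    (.and (.and (flForm 0 s.1) (actForm 0 a.1)) (flForm 1 s'.1))

/-!
Stability is reformulated in the logic of here-and-there: `X` is stable if no valuation strictly
below `X`, taken as the world *here* with `X` as the world *there*, satisfies the rules that `X`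
satisfies (`LPMLN.mem_SM_iff`). A rule whose head atoms have the same truth values in both worlds
is inherited from *there* to *here* (`PForm.ht_imp_of_agree`), so only the rules with an affected
head matter when atoms are removed from `X`.

As each rule of a translation has its head at a single time point, and its body at that time point
and possibly the one before, stability splits over time. A stable model of `D_m` or `Tr(D, m)`
consists of the values of a run and of the utility atoms that the run determines, and a run gives a
stable model iff its initial values satisfy `StateCond` (and the initial laws) and each of its steps
satisfies `StepCond` (`mem_SM_prog_iff`). In one direction, a smaller *here* world at one time point
extends to the whole model (`slice_minimal`); in the other, the fluents of each time point are
forced by those of the one before. The same statement for `D_0` and `D_1` identifies states and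
pf-transitions, so the runs of `Tr(D, m)` are the paths in the transition system of `D`.

The weight of a run is the product of the probabilities of its pf and initpf values
(`weight_interp`), and its utility is the sum of the utilities of its steps (`utilityOf_interp`),
each determined by the two states and the action. The utility is therefore constant on the models of
a history and equal to the sum of the rewards of its steps (`totalReward_eq`). Summing out the
pf values, independent at different times, turns the mass of a sequence of states into the weight of
its first state times the product of the transition probabilities (`mass_eq`, `toMDP_T_eq`). These
sum to one over the target states because the pf values determine the successor (`sum_kernel`), so
the mass of all runs that follow the policy from `s₀` is the weight of `s₀` (`mass_start`), which is
positive by consistency and cancels.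
-/

open PForm

/-! ### Here-and-there satisfaction -/

namespace PForm

variable {α β : Type u}

/-- Classical truth of a formula under a valuation of its atoms. -/
def Ev (x : α → Prop) : PForm α → Prop
  | atom a => x a
  | bot => False
  | and F G => Ev x F ∧ Ev x G
  | or F G => Ev x F ∨ Ev x G
  | imp F G => Ev x F → Ev x G

/-- Satisfaction in the logic of here-and-there, `y` being the valuation in the world *here* and
`x` the one in the world *there*. It is meant for `y ≤ x`. -/
def HT (y x : α → Prop) : PForm α → Prop
  | atom a => y a
  | bot => False
  | and F G => HT y x F ∧ HT y x G
  | or F G => HT y x F ∨ HT y x G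
  | imp F G => (Ev x F → Ev x G) ∧ (HT y x F → HT y x G)

theorem sat_iff_ev (I : Finset α) (F : PForm α) : Sat I F ↔ Ev (· ∈ I) F := by
  induction F <;> simp_all [Sat, Ev]

theorem HT.ev {x y : α → Prop} (h : ∀ a, y a → x a) {F : PForm α} (hF : HT y x F) : Ev x F := by
  induction F with
  | atom a => exact h a hF
  | bot => exact hF
  | and F G ihF ihG => exact ⟨ihF hF.1, ihG hF.2⟩
  | or F G ihF ihG => exact hF.imp ihF ihG
  | imp F G _ _ => exact hF.1

/-- Satisfaction of the reduct is satisfaction in the logic of here-and-there. -/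
theorem sat_reduct_iff_ht {X Y : Finset α} (h : ∀ a, a ∈ Y → a ∈ X) (F : PForm α) :
    Sat Y (reduct X F) ↔ HT (· ∈ Y) (· ∈ X) F := by
  induction F with
  | atom a =>
    unfold reduct
    split_ifs with ha
    · rfl
    · simp only [Sat, HT, false_iff]
      exact fun hy => ha (h a hy)
  | bot => rfl
  | and F G ihF ihG | or F G ihF ihG =>
    unfold reduct
    split_ifs with hs
    · simp only [Sat, HT, ihF, ihG]
    · simp only [Sat, false_iff]
      exact fun hy => hs ((sat_iff_ev _ _).2 (hy.ev h))
  | imp F G ihF ihG =>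
    unfold reduct
    split_ifs with hs
    · rw [sat_iff_ev] at hs
      simp only [Sat, HT, ihF, ihG]
      exact (and_iff_right hs).symm
    · rw [sat_iff_ev] at hs
      simp only [Sat, HT, false_iff]
      exact fun hy => hs hy.1

theorem ev_congr {x x' : α → Prop} {F : PForm α} (h : ∀ a ∈ F.atoms, (x a ↔ x' a)) :
    Ev x F ↔ Ev x' F := by
  induction F with
  | atom a => exact h a (by simp [atoms])
  | bot => rfl
  | and F G ihF ihG | or F G ihF ihG | imp F G ihF ihG =>
    simp only [atoms, List.mem_append] at h
    simp only [Ev, ihF fun a ha => h a (.inl ha), ihG fun a ha => h a (.inr ha)]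

theorem ht_congr {x x' y y' : α → Prop} {F : PForm α} (hx : ∀ a ∈ F.atoms, (x a ↔ x' a))
    (hy : ∀ a ∈ F.atoms, (y a ↔ y' a)) : HT y x F ↔ HT y' x' F := by
  induction F with
  | atom a => exact hy a (by simp [atoms])
  | bot => rfl
  | and F G ihF ihG | or F G ihF ihG | imp F G ihF ihG =>
    simp only [atoms, List.mem_append] at hx hy
    simp only [HT, ihF (fun a ha => hx a (.inl ha)) fun a ha => hy a (.inl ha),
      ihG (fun a ha => hx a (.inr ha)) fun a ha => hy a (.inr ha),
      ev_congr fun a ha => hx a (.inl ha), ev_congr fun a ha => hx a (.inr ha)]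

theorem ht_self (x : α → Prop) (F : PForm α) : HT x x F ↔ Ev x F := by
  induction F <;> simp_all [HT, Ev]

/-- Truth *there* gives truth *here* for a formula on whose atoms the two worlds agree. -/
theorem ht_of_agree {x y : α → Prop} (h : ∀ a, y a → x a) {F : PForm α}
    (hF : ∀ a ∈ F.atoms, x a → y a) (hx : Ev x F) : HT y x F :=
  (ht_congr (fun _ _ => Iff.rfl) fun a ha => ⟨hF a ha, h a⟩).1 ((ht_self x F).2 hx)

/-- A rule that holds *there* holds *here* if the two worlds agree on its head. -/
theorem ht_imp_of_agree {x y : α → Prop} (h : ∀ a, y a → x a) {B F : PForm α}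
    (hF : ∀ a ∈ F.atoms, x a → y a) (hx : Ev x (imp B F)) : HT y x (imp B F) :=
  ⟨hx, fun hB => ht_of_agree h hF (hx (hB.ev h))⟩

theorem ev_map (f : α → β) (x : β → Prop) (F : PForm α) :
    Ev x (F.map f) ↔ Ev (fun a => x (f a)) F := by
  induction F <;> simp_all [map, Ev]

theorem ht_map (f : α → β) (x y : β → Prop) (F : PForm α) :
    HT y x (F.map f) ↔ HT (fun a => y (f a)) (fun a => x (f a)) F := by
  induction F <;> simp_all [map, HT, ev_map]

theorem mem_atoms_map {f : α → β} {F : PForm α} {b : β} :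
    b ∈ (F.map f).atoms ↔ ∃ a ∈ F.atoms, f a = b := by
  induction F <;> simp_all [map, atoms, eq_comm, or_and_right, exists_or]

end PForm

namespace LPMLN

variable {α : Type u}

/-- Stability in terms of here-and-there: no valuation strictly below `X` is a *here* world of
all rules satisfied by `X`. -/
theorem mem_SM_iff (P : LPMLN α) (X : Finset α) :
    X ∈ P.SM ↔ (∀ r ∈ P, r.weight = .hard → Ev (· ∈ X) r.rule.toForm) ∧
      ∀ y : α → Prop, (∀ a, y a → a ∈ X) →
        (∀ r ∈ P, Ev (· ∈ X) r.rule.toForm → HT y (· ∈ X) r.rule.toForm) → ∀ a ∈ X, y a := by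
  classical
  constructor
  · rintro ⟨⟨-, hmin⟩, hh⟩
    refine ⟨fun r hr hw => (sat_iff_ev _ _).1 (hh r hr hw), fun y hy hP => ?_⟩
    by_contra hne
    push Not at hne
    obtain ⟨a, haX, hay⟩ := hne
    have hmem : ∀ b, b ∈ X.filter y ↔ y b := fun b => by
      simp only [Finset.mem_filter, and_iff_right_iff_imp]
      exact hy b
    refine hmin (X.filter y) ?_ ?_
    · exact Finset.filter_ssubset.2 ⟨a, haX, hay⟩
    · rintro F ⟨r, hr, rfl, hs⟩
      rw [sat_reduct_iff_ht (fun b hb => (Finset.mem_filter.1 hb).1)]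
      simp only [hmem]
      exact hP r hr ((sat_iff_ev _ _).1 hs)
  · rintro ⟨hh, hmin⟩
    refine ⟨⟨?_, fun Y hY hP => ?_⟩, fun r hr hw => (sat_iff_ev _ _).2 (hh r hr hw)⟩
    · rintro F ⟨r, -, rfl, hs⟩
      exact hs
    · refine hY.2 (hmin (· ∈ Y) (fun a ha => hY.1 ha) fun r hr hs => ?_)
      rw [← sat_reduct_iff_ht fun a ha => hY.1 ha]
      exact hP _ ⟨r, hr, rfl, (sat_iff_ev _ _).2 hs⟩

end LPMLN

/-! ### Satisfaction of the rules of a translation -/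

section Constraints

variable {α ι : Type u} [Fintype ι]

theorem forall_mem_valueConstraints (f : ι → α) (φ : WRule α → Prop) :
    (∀ r ∈ valueConstraints f, φ r) ↔
      (∀ v w, v ≠ w → φ (hardRule .bot (.and (.atom (f v)) (.atom (f w))))) ∧
        φ (hardRule .bot (.neg (PForm.bigOr fun v => .atom (f v)))) := by
  simp only [valueConstraints, Finset.mem_union, Finset.mem_image, Finset.mem_filter,
    Finset.mem_univ, true_and, Finset.mem_singleton, Prod.exists]
  constructor
  · exact fun h => ⟨fun v w hvw => h _ (.inl ⟨v, w, hvw, rfl⟩), h _ (.inr rfl)⟩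
  · rintro ⟨h, h'⟩ r (⟨v, w, hvw, rfl⟩ | rfl)
    exacts [h v w hvw, h']

theorem ev_bigOr_atom (f : ι → α) (x : Finset α) :
    Ev (· ∈ x) (PForm.bigOr fun v => .atom (f v)) ↔ ∃ v, f v ∈ x := by
  rw [← sat_iff_ev, sat_bigOr]
  rfl

theorem ev_valueConstraints_iff (f : ι → α) (X : Finset α) :
    (∀ r ∈ valueConstraints f, r.weight = .hard → Ev (· ∈ X) r.rule.toForm) ↔
      ∃ v₀, ∀ v, f v ∈ X ↔ v₀ = v := by
  rw [forall_mem_valueConstraints]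
  simp only [hardRule, LPRule.toForm, PForm.neg, Ev, ev_bigOr_atom, forall_const]
  constructor
  · rintro ⟨h, h'⟩
    obtain ⟨v₀, hv₀⟩ := not_not.1 h'
    exact ⟨v₀, fun v => ⟨fun hv => by_contra fun hne => h v₀ v hne ⟨hv₀, hv⟩, fun e => e ▸ hv₀⟩⟩
  · rintro ⟨v₀, h⟩
    refine ⟨fun v w hvw hX => hvw ?_, fun hn => hn ⟨v₀, (h v₀).2 rfl⟩⟩
    rw [← (h v).1 hX.1, ← (h w).1 hX.2]

theorem head_valueConstraints (f : ι → α) : ∀ r ∈ valueConstraints f, r.rule.head = .bot := by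
  rw [forall_mem_valueConstraints]
  exact ⟨fun _ _ _ => rfl, rfl⟩

theorem weight_valueConstraints (f : ι → α) : ∀ r ∈ valueConstraints f, r.weight = .hard := by
  rw [forall_mem_valueConstraints]
  exact ⟨fun _ _ _ => rfl, rfl⟩

theorem ev_boolConstraints_iff (f : Bool → α) (X : Finset α) :
    (∀ r ∈ boolConstraints f, r.weight = .hard → Ev (· ∈ X) r.rule.toForm) ↔
      ∃ v₀, ∀ v, f v ∈ X ↔ v₀ = v := by
  rw [boolConstraints, ev_valueConstraints_iff]
  constructor
  · rintro ⟨v₀, h⟩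
    exact ⟨v₀.down, fun v => (h ⟨v⟩).trans ULift.ext_iff⟩
  · rintro ⟨v₀, h⟩
    exact ⟨⟨v₀⟩, fun v => (h v.down).trans ULift.ext_iff.symm⟩

end Constraints

namespace PBCSignature

variable {S : PBCSignature.{u}}

/-- The fluent atoms true in `s`, as a valuation. -/
def flVal (s : S.FlAssign) : S.Atom → Prop
  | .fl c v => s c = v
  | _ => False

/-- The fluent and action atoms true in `s` and `e`, as a valuation. -/
def actVal (s : S.FlAssign) (e : S.ActAssign) : S.Atom → Prop
  | .fl c v => s c = v
  | .act c v => e c = v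
  | _ => False

/-- The fluent, action and pf atoms true in `s`, `e` and `f`, as a valuation. -/
def pfVal (s : S.FlAssign) (e : S.ActAssign) (f : S.PfAssign) : S.Atom → Prop
  | .fl c v => s c = v
  | .act c v => e c = v
  | .pf c v => f c = v
  | _ => False

/-- The fluent and initpf atoms true in `s` and `g`, as a valuation. -/
def initVal (s : S.FlAssign) (g : S.InitAssign) : S.Atom → Prop
  | .fl c v => s c = v
  | .initpf c v => g c = v
  | _ => False

variable {X : Finset S.TAtom} {i : ℕ} {s : S.FlAssign}

theorem AgreesFl.ev_stampForm (h : AgreesFl X i s) {F : PForm S.Atom}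
    (hF : ∀ a ∈ F.atoms, a.IsFluent) : Ev (· ∈ X) (stampForm i F) ↔ Ev (flVal s) F := by
  rw [stampForm, ev_map]
  refine ev_congr fun a ha => ?_
  have := hF a ha
  cases a <;> simp_all [Atom.IsFluent, flVal, h _ _]

theorem AgreesFl.ht_stampForm (h : AgreesFl X i s) (y : S.TAtom → Prop) {F : PForm S.Atom}
    (hF : ∀ a ∈ F.atoms, a.IsFluent) :
    HT y (· ∈ X) (stampForm i F) ↔ HT (fun a => y (stamp i a)) (flVal s) F := by
  rw [stampForm, ht_map]
  refine ht_congr (fun a ha => ?_) fun a _ => Iff.rfl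
  have := hF a ha
  cases a <;> simp_all [Atom.IsFluent, flVal, h _ _]

theorem AgreesFl.ev_stampForm_act (h : AgreesFl X i s) {e : S.ActAssign} (he : AgreesAct X i e)
    {F : PForm S.Atom} (hF : ∀ a ∈ F.atoms, a.IsFluent ∨ a.IsAction) :
    Ev (· ∈ X) (stampForm i F) ↔ Ev (actVal s e) F := by
  rw [stampForm, ev_map]
  refine ev_congr fun a ha => ?_
  have := hF a ha
  cases a <;> simp_all [Atom.IsFluent, Atom.IsAction, actVal, h _ _, he _ _]

theorem AgreesFl.ev_stampForm_pf (h : AgreesFl X i s) {e : S.ActAssign} (he : AgreesAct X i e)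
    {f : S.PfAssign} (hf : AgreesPf X i f) {F : PForm S.Atom}
    (hF : ∀ a ∈ F.atoms, ¬ a.IsInitPf) :
    Ev (· ∈ X) (stampForm i F) ↔ Ev (pfVal s e f) F := by
  rw [stampForm, ev_map]
  refine ev_congr fun a ha => ?_
  have := hF a ha
  cases a <;> simp_all [Atom.IsInitPf, pfVal, h _ _, he _ _, hf _ _]

theorem AgreesFl.ev_stampForm_init (h : AgreesFl X 0 s) {g : S.InitAssign}
    (hg : AgreesInit X g) {F : PForm S.Atom} (hF : ∀ a ∈ F.atoms, ¬ a.IsAction ∧ ¬ a.IsPf) :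
    Ev (· ∈ X) (stampForm 0 F) ↔ Ev (initVal s g) F := by
  rw [stampForm, ev_map]
  refine ev_congr fun a ha => ?_
  have := hF a ha
  cases a <;> simp_all [Atom.IsAction, Atom.IsPf, initVal, h _ _, hg _ _]

theorem AgreesFl.eq {s' : S.FlAssign} (h : AgreesFl X i s) (h' : AgreesFl X i s') : s = s' :=
  funext fun c => ((h c _).1 ((h' c _).2 rfl))

theorem AgreesAct.eq {e e' : S.ActAssign} (h : AgreesAct X i e) (h' : AgreesAct X i e') :
    e = e' :=
  funext fun c => ((h c _).1 ((h' c _).2 rfl))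

theorem AgreesPf.eq {f f' : S.PfAssign} (h : AgreesPf X i f) (h' : AgreesPf X i f') : f = f' :=
  funext fun c => ((h c _).1 ((h' c _).2 rfl))

theorem AgreesInit.eq {g g' : S.InitAssign} (h : AgreesInit X g) (h' : AgreesInit X g') :
    g = g' :=
  funext fun c => ((h c _).1 ((h' c _).2 rfl))

end PBCSignature

namespace ActionDescription

variable {S : PBCSignature.{u}} (D : ActionDescription S) (m : ℕ)

/-- The program `Tr(D, m)` if `b` is true, and `D_m`, the same without `D_init`, otherwise. -/
noncomputable def prog (b : Bool) : LPMLN S.TAtom := if b then D.Tr m else D.Dm m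

/-- The rule that grounds the `k`-th utility law at the step from `i` to `i + 1`. -/
def utilityRule (i : ℕ) (k : Fin D.utilityLaws.length) : WRule S.TAtom :=
  hardRule (.atom (.utility (D.utilityLaws.get k).v [i + 1, Nat.pair i k]))
    (.and (stampForm (i + 1) (D.utilityLaws.get k).F) (stampForm i (D.utilityLaws.get k).G))

/-- The rules of `D_m` by kind, with time points as elements of `Fin`. -/
theorem forall_mem_Dm (φ : WRule S.TAtom → Prop) :
    (∀ r ∈ D.Dm m, φ r) ↔
      (∀ i : Fin (m + 1), ∀ l ∈ D.staticLaws,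
        φ (hardRule (stampForm i l.F) (stampForm i l.G))) ∧
      (∀ i : Fin m, ∀ l ∈ D.dynamicLaws, φ (hardRule (stampForm (i + 1) l.F)
        (.and (stampForm (i + 1) l.G) (stampForm i l.H)))) ∧
      (∀ c v, S.Regular c → φ (choiceRule (stamp 0 (.fl c v)))) ∧
      (∀ (i : Fin m) c v, φ (choiceRule (stamp i (.act c v)))) ∧
      (∀ (i : Fin m) c v, φ (softFact (Real.log (D.pfProb c v)) (stamp i (.pf c v)))) ∧
      (∀ (i : Fin (m + 1)) c, ∀ r ∈ valueConstraints fun v => stamp (S := S) i (.fl c v), φ r) ∧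
      (∀ (i : Fin m) c, ∀ r ∈ boolConstraints fun v => stamp (S := S) i (.act c v), φ r) ∧
      (∀ (i : Fin m) c, ∀ r ∈ valueConstraints fun v => stamp (S := S) i (.pf c v), φ r) ∧
      (∀ (i : Fin m) k, φ (D.utilityRule i k)) := by
  simp only [Dm, Finset.forall_mem_union, Finset.forall_mem_image, Finset.mem_biUnion,
    Finset.mem_product, Finset.mem_filter, Finset.mem_univ, Finset.mem_range, true_and, and_true,
    Prod.forall, Sigma.forall, Prod.exists, Fin.forall_iff, utilityRule, and_assoc]
  refine and_congr (by grind) (and_congr (by grind) (and_congr (by grind) (and_congr (by grind)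
    (and_congr (by grind) (and_congr ?_ (and_congr ?_ (and_congr ?_ (by grind))))))))
  all_goals exact ⟨fun h i hi c r hr => h r ⟨i, c, hi, hr⟩, fun h r ⟨i, c, hi, hr⟩ => h i hi c r hr⟩

theorem forall_mem_Dinit (φ : WRule S.TAtom → Prop) :
    (∀ r ∈ D.Dinit, φ r) ↔
      (∀ l ∈ D.initialLaws,
        φ (hardRule .bot (.and (.neg (stampForm 0 l.F)) (stampForm 0 l.G)))) ∧
      (∀ c v, φ (softFact (Real.log (D.initProb c v)) (stamp 0 (.initpf c v)))) ∧
      (∀ c, ∀ r ∈ valueConstraints fun v => stamp (S := S) 0 (.fl c v), φ r) ∧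
      (∀ c, ∀ r ∈ valueConstraints fun v => stamp (S := S) 0 (.initpf c v), φ r) := by
  simp only [Dinit, Finset.forall_mem_union, Finset.forall_mem_image, Finset.mem_biUnion,
    Finset.mem_univ, true_and, Sigma.forall, and_assoc]
  refine and_congr Iff.rfl (and_congr (by simp) (and_congr ?_ ?_))
  all_goals exact ⟨fun h c r hr => h r ⟨c, hr⟩, fun h r ⟨c, hr⟩ => h c r hr⟩

theorem forall_mem_prog (b : Bool) (φ : WRule S.TAtom → Prop) :
    (∀ r ∈ D.prog m b, φ r) ↔ (∀ r ∈ D.Dm m, φ r) ∧ (b = true → ∀ r ∈ D.Dinit, φ r) := by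
  cases b
  · simp [prog]
  · simp only [prog, Tr, if_true, Finset.forall_mem_union, forall_const, and_comm]

end ActionDescription

/-! ### Runs and the stable models they determine -/

namespace ActionDescription

variable {S : PBCSignature.{u}}

/-- The values of all constants over `m` steps. The values of the initpf constants are present
for `Tr(D, m)` and absent for `D_m`. -/
structure Run (S : PBCSignature.{u}) (m : ℕ) : Type u where
  fl : Fin (m + 1) → S.FlAssign
  act : Fin m → S.ActAssign
  pf : Fin m → S.PfAssign
  init : Option S.InitAssign

variable (D : ActionDescription S) {m : ℕ}

/-- The `k`-th utility law pays out at the transition from `s` to `s'` by `e`. -/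
def Pays (s : S.FlAssign) (e : S.ActAssign) (s' : S.FlAssign)
    (k : Fin D.utilityLaws.length) : Prop :=
  Ev (flVal s') (D.utilityLaws.get k).F ∧ Ev (actVal s e) (D.utilityLaws.get k).G

/-- The atom `utility(v, i + 1, id)` of the `k`-th utility law. -/
def utilityAtom (i : ℕ) (k : Fin D.utilityLaws.length) : S.TAtom :=
  .utility (D.utilityLaws.get k).v [i + 1, Nat.pair i k]

open Classical in
/-- The interpretation determined by a run: the timestamped values and the utility atoms whose
laws pay out. -/
noncomputable def interp (d : Run S m) : Finset S.TAtom :=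
  (Finset.univ : Finset (Fin (m + 1) × S.Fluent)).image
      (fun p => stamp p.1 (.fl p.2 (d.fl p.1 p.2))) ∪
  (Finset.univ : Finset (Fin m × S.Action)).image
      (fun p => stamp p.1 (.act p.2 (d.act p.1 p.2))) ∪
  (Finset.univ : Finset (Fin m × S.Pf)).image
      (fun p => stamp p.1 (.pf p.2 (d.pf p.1 p.2))) ∪
  d.init.elim ∅ (fun g => (Finset.univ : Finset S.InitPf).image
      (fun c => stamp 0 (.initpf c (g c)))) ∪
  ((Finset.univ : Finset (Fin m × Fin D.utilityLaws.length)).filter fun p =>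
      D.Pays (d.fl p.1.castSucc) (d.act p.1) (d.fl p.1.succ) p.2).image
      (fun p => D.utilityAtom p.1 p.2)

/-- `X` takes the values of the run `d`. -/
structure Agrees (X : Finset S.TAtom) (d : Run S m) : Prop where
  fl : ∀ i : Fin (m + 1), AgreesFl X i (d.fl i)
  act : ∀ i : Fin m, AgreesAct X i (d.act i)
  pf : ∀ i : Fin m, AgreesPf X i (d.pf i)
  init : ∀ g ∈ d.init, AgreesInit X g

theorem Agrees.fl_castSucc {X : Finset S.TAtom} {d : Run S m} (h : Agrees X d) (i : Fin m) :
    AgreesFl X i (d.fl i.castSucc) := h.fl i.castSucc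

theorem Agrees.fl_succ {X : Finset S.TAtom} {d : Run S m} (h : Agrees X d) (i : Fin m) :
    AgreesFl X (i + 1) (d.fl i.succ) := h.fl i.succ

theorem mem_interp (d : Run S m) (a : S.TAtom) : a ∈ D.interp d ↔
    (∃ (i : Fin (m + 1)) (c : S.Fluent), stamp i (.fl c (d.fl i c)) = a) ∨
    (∃ (i : Fin m) (c : S.Action), stamp i (.act c (d.act i c)) = a) ∨
    (∃ (i : Fin m) (c : S.Pf), stamp i (.pf c (d.pf i c)) = a) ∨
    (∃ g ∈ d.init, ∃ c : S.InitPf, stamp 0 (.initpf c (g c)) = a) ∨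
    (∃ (i : Fin m) (k : Fin D.utilityLaws.length),
      D.Pays (d.fl i.castSucc) (d.act i) (d.fl i.succ) k ∧ D.utilityAtom i k = a) := by
  simp only [interp, Finset.mem_union, Finset.mem_image, Finset.mem_univ, true_and,
    Prod.exists, Finset.mem_filter, or_assoc]
  cases d.init <;> simp

theorem stamp_inj {i j : ℕ} {a b : S.Atom} : stamp i a = stamp j b ↔ i = j ∧ a = b := by
  simp [stamp]

theorem utilityAtom_inj {i j : ℕ} {k l : Fin D.utilityLaws.length} :
    D.utilityAtom i k = D.utilityAtom j l ↔ i = j ∧ k = l := by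
  simp only [utilityAtom, UAtom.utility.injEq, List.cons.injEq, Nat.pair_eq_pair, and_true]
  constructor
  · exact fun h => ⟨h.2.2.1, Fin.ext h.2.2.2⟩
  · rintro ⟨rfl, rfl⟩
    simp

theorem utilityAtom_ne_stamp {i j : ℕ} {a : S.Atom} {k : Fin D.utilityLaws.length} :
    D.utilityAtom j k ≠ stamp i a := by
  simp [stamp, utilityAtom]

theorem stamp_ne_utilityAtom {i j : ℕ} {a : S.Atom} {k : Fin D.utilityLaws.length} :
    stamp i a ≠ D.utilityAtom j k :=
  D.utilityAtom_ne_stamp.symm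

theorem agrees_interp (d : Run S m) : Agrees (D.interp d) d := by
  constructor
  · intro i c v
    simp only [mem_interp, stamp_inj, utilityAtom_ne_stamp]
    constructor
    · rintro (⟨j, c', hj, h⟩ | h)
      · cases Fin.ext hj
        cases h
        rfl
      · simp at h
    · rintro rfl
      exact .inl ⟨i, c, rfl, rfl⟩
  · intro i c v
    simp only [mem_interp, stamp_inj, utilityAtom_ne_stamp]
    constructor
    · rintro (h | ⟨j, c', hj, h⟩ | h)
      · simp at h
      · cases Fin.ext hj
        cases h
        rfl
      · simp at h
    · rintro rfl
      exact .inr (.inl ⟨i, c, rfl, rfl⟩)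
  · intro i c v
    simp only [mem_interp, stamp_inj, utilityAtom_ne_stamp]
    constructor
    · rintro (h | h | ⟨j, c', hj, h⟩ | h)
      · simp at h
      · simp at h
      · cases Fin.ext hj
        cases h
        rfl
      · simp at h
    · rintro rfl
      exact .inr (.inr (.inl ⟨i, c, rfl, rfl⟩))
  · intro g hg c v
    simp only [mem_interp, stamp_inj, utilityAtom_ne_stamp]
    constructor
    · rintro (h | h | h | ⟨g', hg', c', -, h⟩ | h)
      · simp at h
      · simp at h
      · simp at h
      · cases Option.mem_unique hg hg'
        cases h
        rfl
      · simp at h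
    · rintro rfl
      exact .inr (.inr (.inr (.inl ⟨g, hg, c, trivial, rfl⟩)))

theorem utilityAtom_mem_interp (d : Run S m) (i : Fin m) (k : Fin D.utilityLaws.length) :
    D.utilityAtom i k ∈ D.interp d ↔
      D.Pays (d.fl i.castSucc) (d.act i) (d.fl i.succ) k := by
  simp only [mem_interp, utilityAtom_inj, stamp_ne_utilityAtom, Fin.val_inj]
  constructor
  · rintro (h | h | h | h | ⟨j, l, h, rfl, rfl⟩)
    · simp at h
    · simp at h
    · simp at h
    · simp at h
    · exact h
  · exact fun h => .inr (.inr (.inr (.inr ⟨i, k, h, rfl, rfl⟩)))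

/-- The bodies of the ground utility rules only depend on the run. -/
theorem Agrees.ev_utilityRule_body {X : Finset S.TAtom} {d : Run S m} (h : Agrees X d)
    (i : Fin m) (k : Fin D.utilityLaws.length) :
    Ev (· ∈ X) (D.utilityRule i k).rule.body ↔
      D.Pays (d.fl i.castSucc) (d.act i) (d.fl i.succ) k := by
  simp only [utilityRule, hardRule, Ev, Pays]
  rw [(h.fl_succ i).ev_stampForm (D.utilityLaws.get k).fluent_F,
    (h.fl_castSucc i).ev_stampForm_act (h.act i) (D.utilityLaws.get k).fluent_action_G]

theorem mem_atoms_stampForm_fluent {F : PForm S.Atom} (hF : ∀ a ∈ F.atoms, a.IsFluent) {i : ℕ}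
    {a : S.TAtom} (ha : a ∈ (stampForm i F).atoms) : ∃ c v, a = stamp i (.fl c v) := by
  obtain ⟨b, hb, rfl⟩ := mem_atoms_map.1 ha
  have := hF b hb
  cases b with
  | fl c v => exact ⟨c, v, rfl⟩
  | _ => exact this.elim

theorem mem_atoms_stampForm_regular {F : PForm S.Atom} (hF : ∀ a ∈ F.atoms, a.IsRegular) {i : ℕ}
    {a : S.TAtom} (ha : a ∈ (stampForm i F).atoms) :
    ∃ c v, S.Regular c ∧ a = stamp i (.fl c v) := by
  obtain ⟨b, hb, rfl⟩ := mem_atoms_map.1 ha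
  have := hF b hb
  cases b with
  | fl c v => exact ⟨c, v, this, rfl⟩
  | _ => exact this.elim

theorem isFluent_of_isRegular {a : S.Atom} (h : a.IsRegular) : a.IsFluent := by
  cases a <;> first | exact trivial | exact h.elim

theorem exists_agrees_of_constraints {b : Bool} {X : Finset S.TAtom}
    (h : ∀ r ∈ D.prog m b, r.weight = .hard → Ev (· ∈ X) r.rule.toForm) :
    ∃ d : Run S m, d.init.isSome = b ∧ Agrees X d := by
  rw [forall_mem_prog, forall_mem_Dm] at h
  obtain ⟨⟨-, -, -, -, -, hfl, hact, hpf, -⟩, hinit⟩ := h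
  simp only [ev_valueConstraints_iff, ev_boolConstraints_iff] at hfl hact hpf
  choose fl hfl using hfl
  choose act hact using hact
  choose pf hpf using hpf
  cases b with
  | false => exact ⟨⟨fl, act, pf, none⟩, rfl, hfl, hact, hpf, by simp⟩
  | true =>
    have hinit := hinit rfl
    rw [forall_mem_Dinit] at hinit
    obtain ⟨-, -, -, hinit⟩ := hinit
    simp only [ev_valueConstraints_iff] at hinit
    choose g hg using hinit
    refine ⟨⟨fl, act, pf, some g⟩, rfl, hfl, hact, hpf, ?_⟩
    rintro _ ⟨⟩
    exact hg

/-- A rule all of whose head atoms agree *here* and *there* is inherited *here*. -/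
theorem ht_rule {α : Type u} {x y : α → Prop} {r : WRule α} (h : ∀ a, y a → x a)
    (hF : ∀ a ∈ r.rule.head.atoms, x a → y a) (hx : Ev x r.rule.toForm) : HT y x r.rule.toForm :=
  ht_imp_of_agree h hF hx

/-- A stable model contains no atoms but those its run accounts for, since no other atom is
supported by a rule. -/
theorem eq_interp_of_agrees {b : Bool} {X : Finset S.TAtom} (hX : X ∈ (D.prog m b).SM)
    {d : Run S m} (hb : d.init.isSome = b) (hd : Agrees X d) : X = D.interp d := by
  rw [LPMLN.mem_SM_iff] at hX
  obtain ⟨hh, hmin⟩ := hX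
  have hd' := D.agrees_interp d
  have hsub : ∀ a, a ∈ D.interp d → a ∈ X := by
    intro a ha
    rw [forall_mem_prog, forall_mem_Dm] at hh
    obtain ⟨⟨-, -, -, -, -, -, -, -, hu⟩, -⟩ := hh
    rw [mem_interp] at ha
    obtain ⟨i, c, rfl⟩ | ⟨i, c, rfl⟩ | ⟨i, c, rfl⟩ | ⟨g, hg, c, rfl⟩ | ⟨i, k, hk, rfl⟩ := ha
    · exact (hd.fl i c _).2 rfl
    · exact (hd.act i c _).2 rfl
    · exact (hd.pf i c _).2 rfl
    · exact (hd.init g hg c _).2 rfl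
    · exact hu i k rfl ((hd.ev_utilityRule_body D i k).2 hk)
  refine Finset.Subset.antisymm (hmin (· ∈ D.interp d) hsub ?_) hsub
  rw [forall_mem_prog, forall_mem_Dm, forall_mem_Dinit]
  have hfl : ∀ (i : Fin (m + 1)) c v, stamp i (.fl c v) ∈ X → stamp i (.fl c v) ∈ D.interp d :=
    fun i c v h => (hd'.fl i c v).2 ((hd.fl i c v).1 h)
  refine ⟨⟨?_, ?_, ?_, ?_, ?_, ?_, ?_, ?_, ?_⟩, fun hbt => ⟨?_, ?_, ?_, ?_⟩⟩
  · intro i l _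
    refine ht_rule hsub fun a ha => ?_
    obtain ⟨c, v, rfl⟩ := mem_atoms_stampForm_fluent l.fluent_F ha
    exact hfl i c v
  · intro i l _
    refine ht_rule hsub fun a ha => ?_
    obtain ⟨c, v, -, rfl⟩ := mem_atoms_stampForm_regular l.regular_F ha
    exact hfl i.succ c v
  · intro c v _
    refine ht_rule hsub fun a ha => ?_
    obtain rfl := List.mem_singleton.1 ha
    exact hfl 0 c v
  · intro i c v
    refine ht_rule hsub fun a ha => ?_
    obtain rfl := List.mem_singleton.1 ha
    exact fun h => (hd'.act i c v).2 ((hd.act i c v).1 h)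
  · intro i c v
    refine ht_rule hsub fun a ha => ?_
    obtain rfl := List.mem_singleton.1 ha
    exact fun h => (hd'.pf i c v).2 ((hd.pf i c v).1 h)
  · intro i c r hr
    exact ht_rule hsub (by simp [head_valueConstraints _ r hr, atoms])
  · intro i c r hr
    exact ht_rule hsub (by simp [head_valueConstraints _ r hr, atoms])
  · intro i c r hr
    exact ht_rule hsub (by simp [head_valueConstraints _ r hr, atoms])
  · intro i k h
    exact ⟨h, fun hB => (D.utilityAtom_mem_interp d i k).2
      ((hd.ev_utilityRule_body D i k).1 (hB.ev hsub))⟩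
  · intro l _
    exact ht_rule hsub (by simp [hardRule, atoms])
  · intro c v
    refine ht_rule hsub fun a ha => ?_
    obtain rfl := List.mem_singleton.1 ha
    obtain ⟨g, hg⟩ := Option.isSome_iff_exists.1 (hb.trans hbt)
    exact fun h => (hd'.init g hg c v).2 ((hd.init g hg c v).1 h)
  · intro c r hr
    exact ht_rule hsub (by simp [head_valueConstraints _ r hr, atoms])
  · intro c r hr
    exact ht_rule hsub (by simp [head_valueConstraints _ r hr, atoms])

end ActionDescription

/-! ### Stable models as runs satisfying local conditions -/

namespace ActionDescription

variable {S : PBCSignature.{u}} (D : ActionDescription S) {m : ℕ}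

/-- The fluent values `s` satisfy the static laws, and the statically determined ones among them
are forced by the static laws once the regular ones are given. -/
def StateCond (s : S.FlAssign) : Prop :=
  (∀ l ∈ D.staticLaws, Ev (flVal s) (.imp l.G l.F)) ∧
    ∀ y : S.Atom → Prop, (∀ a, y a → flVal s a) → (∀ a, a.IsRegular → flVal s a → y a) →
      (∀ l ∈ D.staticLaws, HT y (flVal s) (.imp l.G l.F)) → ∀ a, flVal s a → y a

/-- After `s`, `e` and `f`, the fluent values `s'` satisfy the static laws and the dynamic laws
that apply, and they are all forced by these laws. -/
def StepCond (s : S.FlAssign) (e : S.ActAssign) (f : S.PfAssign) (s' : S.FlAssign) : Prop :=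
  (∀ l ∈ D.staticLaws, Ev (flVal s') (.imp l.G l.F)) ∧
  (∀ l ∈ D.dynamicLaws, Ev (pfVal s e f) l.H → Ev (flVal s') (.imp l.G l.F)) ∧
    ∀ y : S.Atom → Prop, (∀ a, y a → flVal s' a) →
      (∀ l ∈ D.staticLaws, HT y (flVal s') (.imp l.G l.F)) →
      (∀ l ∈ D.dynamicLaws, Ev (pfVal s e f) l.H → HT y (flVal s') (.imp l.G l.F)) →
      ∀ a, flVal s' a → y a

/-- The initial laws hold for the fluent values `s` and the initpf values `g`. -/
def InitCond (s : S.FlAssign) (g : S.InitAssign) : Prop :=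
  ∀ l ∈ D.initialLaws, Ev (initVal s g) l.G → Ev (flVal s) l.F

/-- The local conditions on a run to be a stable model. -/
structure Valid (d : Run S m) : Prop where
  state : D.StateCond (d.fl 0)
  step : ∀ i : Fin m, D.StepCond (d.fl i.castSucc) (d.act i) (d.pf i) (d.fl i.succ)
  init : ∀ g ∈ d.init, D.InitCond (d.fl 0) g

/-- Dynamic laws have regular heads, so where all regular atoms are given they add nothing to the
static laws. Every successor is therefore a state. -/
theorem StepCond.stateCond {s : S.FlAssign} {e : S.ActAssign} {f : S.PfAssign} {s' : S.FlAssign}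
    (h : D.StepCond s e f s') : D.StateCond s' :=
  ⟨h.1, fun y hy hreg hst => h.2.2 y hy hst fun l hl hH =>
    ht_imp_of_agree hy (fun a ha => hreg a (l.regular_F a ha)) (h.2.1 l hl hH)⟩

/-- In a stable model, a *here* valuation of the fluents of a single time point that satisfies
the laws about this time point cannot be proper: extended by the remaining atoms of the model it
satisfies all rules, as those with heads at other time points are inherited. -/
theorem slice_minimal {b : Bool} {d : Run S m} (hX : D.interp d ∈ (D.prog m b).SM)
    (j : Fin (m + 1)) (y : S.Atom → Prop) (hy : ∀ a, y a → flVal (d.fl j) a)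
    (hreg : j = 0 → ∀ a, a.IsRegular → flVal (d.fl j) a → y a)
    (hst : ∀ l ∈ D.staticLaws, HT y (flVal (d.fl j)) (.imp l.G l.F))
    (hdyn : ∀ i : Fin m, i.succ = j → ∀ l ∈ D.dynamicLaws,
      Ev (pfVal (d.fl i.castSucc) (d.act i) (d.pf i)) l.H →
        HT y (flVal (d.fl j)) (.imp l.G l.F)) :
    ∀ a, flVal (d.fl j) a → y a := by
  rw [LPMLN.mem_SM_iff] at hX
  obtain ⟨-, hmin⟩ := hX
  have hd := D.agrees_interp d
  set X := D.interp d with hXdef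
  -- The world *here*: `y` at the fluents of time `j`, and `X` at all other atoms.
  let z : S.TAtom → Prop := fun a => a ∈ X ∧ ∀ c v, a = stamp j (.fl c v) → y (.fl c v)
  have hz : ∀ a, z a → a ∈ X := fun a h => h.1
  -- At fluent formulas stamped `j`, the pair `z`, `X` amounts to the pair `y`, `flVal (d.fl j)`.
  have hzj : ∀ F : PForm S.Atom, (∀ a ∈ F.atoms, a.IsFluent) →
      (HT z (· ∈ X) (stampForm j F) ↔ HT y (flVal (d.fl j)) F) := by
    intro F hF
    rw [(hd.fl j).ht_stampForm z hF]
    refine ht_congr (fun _ _ => Iff.rfl) fun a ha => ?_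
    have := hF a ha
    cases a with
    | fl c v =>
      refine ⟨fun h => h.2 c v rfl, fun h => ⟨(hd.fl j c v).2 (hy _ h), fun c' v' e => ?_⟩⟩
      rw [stamp_inj] at e
      rwa [← e.2]
    | _ => exact this.elim
  have hother : ∀ i : ℕ, i ≠ j → ∀ a, stamp i a ∈ X → z (stamp i a) := fun i hi a h =>
    ⟨h, fun c v e => absurd (stamp_inj.1 e).1 hi⟩
  have hnotfl : ∀ i a, ¬ a.IsFluent → stamp i a ∈ X → z (stamp i a) := fun i a ha h =>
    ⟨h, fun c v e => absurd ((stamp_inj.1 e).2 ▸ trivial) ha⟩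
  have key := hmin z hz ?_
  · intro a ha
    cases a with
    | fl c v => exact (key _ ((hd.fl j c v).2 ha)).2 c v rfl
    | _ => exact ha.elim
  rw [forall_mem_prog, forall_mem_Dm, forall_mem_Dinit]
  refine ⟨⟨?_, ?_, ?_, ?_, ?_, ?_, ?_, ?_, ?_⟩, fun _ => ⟨?_, ?_, ?_, ?_⟩⟩
  · intro i l hl h
    by_cases hij : i = j
    · subst hij
      refine ⟨h, fun hB => ?_⟩
      exact (hzj _ l.fluent_F).2 ((hst l hl).2 ((hzj _ l.fluent_G).1 hB))
    · refine ht_rule hz (fun a ha => ?_) h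
      obtain ⟨c, v, rfl⟩ := mem_atoms_stampForm_fluent l.fluent_F ha
      exact hother i (fun e => hij (Fin.ext e)) _
  · intro i l hl h
    by_cases hij : i.succ = j
    · subst hij
      refine ⟨h, fun hB => ?_⟩
      refine (hzj _ fun a ha => isFluent_of_isRegular (l.regular_F a ha)).2 ?_
      refine (hdyn i rfl l hl ?_).2 ((hzj _ l.fluent_G).1 hB.1)
      exact ((hd.fl_castSucc i).ev_stampForm_pf (hd.act i) (hd.pf i) l.no_initpf_H).1 (hB.2.ev hz)
    · refine ht_rule hz (fun a ha => ?_) h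
      obtain ⟨c, v, -, rfl⟩ := mem_atoms_stampForm_regular l.regular_F ha
      exact hother i.succ (fun e => hij (Fin.ext e)) _
  · intro c v hc
    refine ht_rule hz fun a ha => ?_
    obtain rfl := List.mem_singleton.1 ha
    intro h
    by_cases hj : j = 0
    · subst hj
      refine ⟨h, fun c' v' e => ?_⟩
      rw [← (stamp_inj.1 e).2]
      exact hreg rfl (.fl c v) hc ((hd.fl 0 c v).1 h)
    · exact hother 0 (fun e => hj (Fin.ext e.symm)) _ h
  · intro i c v
    refine ht_rule hz fun a ha => ?_
    obtain rfl := List.mem_singleton.1 ha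
    exact hnotfl i _ id
  · intro i c v
    refine ht_rule hz fun a ha => ?_
    obtain rfl := List.mem_singleton.1 ha
    exact hnotfl i _ id
  · intro i c r hr
    exact ht_rule hz (by simp [head_valueConstraints _ r hr, atoms])
  · intro i c r hr
    exact ht_rule hz (by simp [head_valueConstraints _ r hr, atoms])
  · intro i c r hr
    exact ht_rule hz (by simp [head_valueConstraints _ r hr, atoms])
  · intro i k
    refine ht_rule hz fun a ha => ?_
    obtain rfl := List.mem_singleton.1 ha
    exact fun h => ⟨h, fun c v e => absurd e D.utilityAtom_ne_stamp⟩
  · intro l _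
    exact ht_rule hz (by simp [hardRule, atoms])
  · intro c v
    refine ht_rule hz fun a ha => ?_
    obtain rfl := List.mem_singleton.1 ha
    exact hnotfl 0 _ id
  · intro c r hr
    exact ht_rule hz (by simp [head_valueConstraints _ r hr, atoms])
  · intro c r hr
    exact ht_rule hz (by simp [head_valueConstraints _ r hr, atoms])

theorem valid_of_interp_mem_SM {b : Bool} {d : Run S m} (hb : d.init.isSome = b)
    (hX : D.interp d ∈ (D.prog m b).SM) : D.Valid d := by
  have hmin := D.slice_minimal hX
  rw [LPMLN.mem_SM_iff] at hX
  obtain ⟨hh, -⟩ := hX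
  have hd := D.agrees_interp d
  rw [forall_mem_prog, forall_mem_Dm, forall_mem_Dinit] at hh
  obtain ⟨⟨hst, hdyn, -⟩, hinit⟩ := hh
  have hst' : ∀ (i : Fin (m + 1)), ∀ l ∈ D.staticLaws, Ev (flVal (d.fl i)) (.imp l.G l.F) := by
    intro i l hl hG
    exact ((hd.fl i).ev_stampForm l.fluent_F).1
      (hst i l hl rfl (((hd.fl i).ev_stampForm l.fluent_G).2 hG))
  refine ⟨⟨hst' 0, fun y hy hreg hy' => ?_⟩, fun i => ⟨hst' _, fun l hl hH hG => ?_,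
    fun y hy hy' hy'' => ?_⟩, fun g hg l hl hG => ?_⟩
  · exact hmin 0 y hy (fun _ => hreg) hy' fun i hi => absurd hi (Fin.succ_ne_zero i)
  · refine ((hd.fl_succ i).ev_stampForm fun a ha => isFluent_of_isRegular (l.regular_F a ha)).1 ?_
    exact hdyn i l hl rfl ⟨((hd.fl_succ i).ev_stampForm l.fluent_G).2 hG,
      ((hd.fl_castSucc i).ev_stampForm_pf (hd.act i) (hd.pf i) l.no_initpf_H).2 hH⟩
  · refine hmin i.succ y hy (fun h => absurd h (Fin.succ_ne_zero i)) hy' fun i' hi' l hl => ?_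
    cases Fin.succ_injective _ hi'
    exact hy'' l hl
  · by_contra hF
    have hbt : b = true := hb ▸ Option.isSome_iff_exists.2 ⟨g, hg⟩
    exact (hinit hbt).1 l hl rfl ⟨fun h => hF (((hd.fl 0).ev_stampForm l.fluent_F).1 h),
      ((hd.fl 0).ev_stampForm_init (hd.init g hg) l.no_action_pf_G).2 hG⟩

/-- The local conditions suffice for stability: going through the time points in order, the fluents
of each are forced once those of the previous one are. -/
theorem interp_mem_SM_of_valid {b : Bool} {d : Run S m} (hb : d.init.isSome = b)
    (hv : D.Valid d) : D.interp d ∈ (D.prog m b).SM := by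
  rw [LPMLN.mem_SM_iff]
  have hd := D.agrees_interp d
  set X := D.interp d with hXdef
  have hst : ∀ (i : Fin (m + 1)), ∀ l ∈ D.staticLaws, Ev (flVal (d.fl i)) (.imp l.G l.F) := by
    intro i
    induction i using Fin.cases with
    | zero => exact hv.state.1
    | succ i => exact (hv.step i).1
  constructor
  · rw [forall_mem_prog, forall_mem_Dm, forall_mem_Dinit]
    refine ⟨⟨?_, ?_, ?_, ?_, ?_, ?_, ?_, ?_, ?_⟩, fun hbt => ⟨?_, ?_, ?_, ?_⟩⟩
    · intro i l hl _ hG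
      exact ((hd.fl i).ev_stampForm l.fluent_F).2
        (hst i l hl (((hd.fl i).ev_stampForm l.fluent_G).1 hG))
    · intro i l hl _ hB
      refine ((hd.fl_succ i).ev_stampForm
        fun a ha => isFluent_of_isRegular (l.regular_F a ha)).2 ?_
      exact (hv.step i).2.1 l hl
        (((hd.fl_castSucc i).ev_stampForm_pf (hd.act i) (hd.pf i) l.no_initpf_H).1 hB.2)
        (((hd.fl_succ i).ev_stampForm l.fluent_G).1 hB.1)
    · exact fun c v _ _ h => not_not.1 h
    · exact fun i c v _ h => not_not.1 h
    · exact fun i c v h => nomatch h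
    · exact fun i c => (ev_valueConstraints_iff _ _).2 ⟨_, hd.fl i c⟩
    · exact fun i c => (ev_boolConstraints_iff _ _).2 ⟨_, hd.act i c⟩
    · exact fun i c => (ev_valueConstraints_iff _ _).2 ⟨_, hd.pf i c⟩
    · intro i k _ hB
      exact (D.utilityAtom_mem_interp d i k).2 ((hd.ev_utilityRule_body D i k).1 hB)
    · obtain ⟨g, hg⟩ := Option.isSome_iff_exists.1 (hb.trans hbt)
      intro l hl _ hB
      exact hB.1 (((hd.fl 0).ev_stampForm l.fluent_F).2 (hv.init g hg l hl
        (((hd.fl 0).ev_stampForm_init (hd.init g hg) l.no_action_pf_G).1 hB.2)))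
    · exact fun c v h => nomatch h
    · exact fun c => (ev_valueConstraints_iff _ _).2 ⟨_, hd.fl 0 c⟩
    · obtain ⟨g, hg⟩ := Option.isSome_iff_exists.1 (hb.trans hbt)
      exact fun c => (ev_valueConstraints_iff _ _).2 ⟨_, hd.init g hg c⟩
  · intro y hy hP
    have htop : Ev (· ∈ X) PForm.top ∧ HT y (· ∈ X) PForm.top := ⟨id, id, id⟩
    rw [forall_mem_prog, forall_mem_Dm, forall_mem_Dinit] at hP
    obtain ⟨⟨hyst, hydyn, hychoice, hyact, hypf, -, -, -, hyu⟩, hyinit⟩ := hP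
    -- The body `¬¬A` of a choice rule holds *here* as soon as `A ∈ X`, which forces `A` *here*.
    have hact : ∀ (i : Fin m) c v, stamp i (.act c v) ∈ X → y (stamp i (.act c v)) := by
      intro i c v h
      exact (hyact i c v fun _ => h).2 ⟨fun h' => h' h, fun h' => absurd h h'.1⟩
    have hpf : ∀ (i : Fin m) c v, stamp i (.pf c v) ∈ X → y (stamp i (.pf c v)) := by
      intro i c v h
      exact (hypf i c v fun _ => h).2 htop.2
    have hslice : ∀ (i : Fin (m + 1)) a, y (stamp i a) ∧ a.IsFluent → flVal (d.fl i) a := by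
      rintro i (⟨c, v⟩ | _ | _ | _) ⟨h, hf⟩
      · exact (hd.fl i c v).1 (hy _ h)
      all_goals exact hf.elim
    -- A valuation restricted to the fluents has the same value at fluent formulas.
    have hres : ∀ (i : Fin (m + 1)) (F : PForm S.Atom), (∀ a ∈ F.atoms, a.IsFluent) →
        (HT y (· ∈ X) (stampForm i F) ↔
          HT (fun a => y (stamp i a) ∧ a.IsFluent) (flVal (d.fl i)) F) := by
      intro i F hF
      rw [(hd.fl i).ht_stampForm y hF]
      exact ht_congr (fun _ _ => Iff.rfl) fun a ha => (and_iff_left (hF a ha)).symm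
    have hstat : ∀ (i : Fin (m + 1)), ∀ l ∈ D.staticLaws,
        HT (fun a => y (stamp i a) ∧ a.IsFluent) (flVal (d.fl i)) (.imp l.G l.F) := by
      intro i l hl
      refine ⟨hst i l hl, fun hG => ?_⟩
      refine (hres i _ l.fluent_F).1 ((hyst i l hl fun hG' => ?_).2 ((hres i _ l.fluent_G).2 hG))
      exact ((hd.fl i).ev_stampForm l.fluent_F).2
        (hst i l hl (((hd.fl i).ev_stampForm l.fluent_G).1 hG'))
    have hfl : ∀ (i : Fin (m + 1)) a, flVal (d.fl i) a → y (stamp i a) ∧ a.IsFluent := by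
      intro i
      induction i using Fin.induction with
      | zero =>
        refine hv.state.2 _ (hslice 0) ?_ (hstat 0)
        rintro (⟨c, v⟩ | _ | _ | _) hreg ha
        · have hmem : stamp 0 (.fl c v) ∈ X := (hd.fl 0 c v).2 ha
          exact ⟨(hychoice c v hreg fun _ => hmem).2
            ⟨fun h' => h' hmem, fun h' => absurd hmem h'.1⟩, trivial⟩
        all_goals exact hreg.elim
      | succ i ih =>
        refine (hv.step i).2.2 _ (hslice i.succ) (hstat i.succ) fun l hl hH => ?_
        have hlF : ∀ a ∈ l.F.atoms, a.IsFluent :=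
          fun a ha => isFluent_of_isRegular (l.regular_F a ha)
        refine ⟨(hv.step i).2.1 l hl hH, fun hG => ?_⟩
        refine (hres i.succ _ hlF).1 ((hydyn i l hl fun hB => ?_).2
          ⟨(hres i.succ _ l.fluent_G).2 hG, ?_⟩)
        · exact ((hd.fl_succ i).ev_stampForm hlF).2
            ((hv.step i).2.1 l hl hH (((hd.fl_succ i).ev_stampForm l.fluent_G).1 hB.1))
        · refine ht_of_agree hy (fun a ha => ?_)
            (((hd.fl_castSucc i).ev_stampForm_pf (hd.act i) (hd.pf i) l.no_initpf_H).2 hH)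
          obtain ⟨b, hb, rfl⟩ := mem_atoms_map.1 ha
          intro hX
          cases b with
          | fl c v => exact (ih (.fl c v) ((hd.fl_castSucc i c v).1 hX)).1
          | act c v => exact hact i c v hX
          | pf c v => exact hpf i c v hX
          | initpf c v => exact absurd trivial (l.no_initpf_H _ hb)
    intro a ha
    rw [hXdef, mem_interp] at ha
    obtain ⟨i, c, rfl⟩ | ⟨i, c, rfl⟩ | ⟨i, c, rfl⟩ | ⟨g, hg, c, rfl⟩ | ⟨i, k, hk, rfl⟩ := ha
    · exact (hfl i (.fl c _) rfl).1
    · exact hact i c _ ((hd.act i c _).2 rfl)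
    · exact hpf i c _ ((hd.pf i c _).2 rfl)
    · have hbt : b = true := hb ▸ Option.isSome_iff_exists.2 ⟨g, hg⟩
      exact ((hyinit hbt).2.1 c _ fun _ => (hd.init g hg c _).2 rfl).2 htop.2
    · refine (hyu i k fun _ => (D.utilityAtom_mem_interp d i k).2 hk).2 ?_
      refine ht_of_agree hy (fun a ha hX => ?_) ((hd.ev_utilityRule_body D i k).2 hk)
      rcases List.mem_append.1 ha with ha | ha
      · obtain ⟨c, v, rfl⟩ := mem_atoms_stampForm_fluent (D.utilityLaws.get k).fluent_F ha
        exact (hfl i.succ (.fl c v) ((hd.fl_succ i c v).1 hX)).1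
      · obtain ⟨b, hb, rfl⟩ := mem_atoms_map.1 ha
        have := (D.utilityLaws.get k).fluent_action_G b hb
        cases b with
        | fl c v => exact (hfl i.castSucc (.fl c v) ((hd.fl_castSucc i c v).1 hX)).1
        | act c v => exact hact i c v hX
        | pf c v => exact (this.elim id id).elim
        | initpf c v => exact (this.elim id id).elim

/-- The stable models of `D_m` and of `Tr(D, m)` are the interpretations determined by the runs
that satisfy the local conditions. -/
theorem mem_SM_prog_iff {b : Bool} {X : Finset S.TAtom} : X ∈ (D.prog m b).SM ↔
    ∃ d : Run S m, d.init.isSome = b ∧ D.Valid d ∧ X = D.interp d := by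
  constructor
  · intro hX
    obtain ⟨d, hb, hd⟩ := D.exists_agrees_of_constraints ((LPMLN.mem_SM_iff _ _).1 hX).1
    obtain rfl := D.eq_interp_of_agrees hX hb hd
    exact ⟨d, hb, D.valid_of_interp_mem_SM hb hX, rfl⟩
  · rintro ⟨d, hb, hv, rfl⟩
    exact D.interp_mem_SM_of_valid hb hv

end ActionDescription

/-! ### Conditional probabilities and expected utilities without normalization -/

namespace LPMLN

variable {α : Type u} (P : LPMLN α)

open Classical in
/-- The total weight of the models of `P` that satisfy `A`. -/
noncomputable def mass (A : PForm α) : ℝ := ∑ I ∈ P.models, if PForm.Sat I A then P.weight I else 0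

theorem mem_models {I : Finset α} : I ∈ P.models ↔ I ∈ P.SM := by
  simp [models]

theorem probOf_eq (A : PForm α) : P.probOf A = P.mass A / ∑ J ∈ P.models, P.weight J := by
  simp only [probOf, prob, mass, Finset.sum_div, Finset.sum_filter, ite_div, zero_div]

theorem mass_nonneg (A : PForm α) : 0 ≤ P.mass A := by
  refine Finset.sum_nonneg fun I _ => ?_
  split_ifs
  · exact P.weight_nonneg I
  · exact le_rfl

theorem mass_le (A : PForm α) : P.mass A ≤ ∑ J ∈ P.models, P.weight J := by
  refine Finset.sum_le_sum fun I _ => ?_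
  split_ifs
  · exact le_rfl
  · exact P.weight_nonneg I

theorem condProb_eq (A B : PForm α) : P.condProb A B = P.mass (.and A B) / P.mass B := by
  rw [condProb, probOf_eq, probOf_eq]
  by_cases h : ∑ J ∈ P.models, P.weight J = 0
  · -- Both sides are `x / 0`.
    have hB : P.mass B = 0 := le_antisymm ((P.mass_le B).trans h.le) (P.mass_nonneg B)
    simp [h, hB]
  · exact div_div_div_cancel_right₀ h _ _

theorem weight_pos {I : Finset α} (h : I ∈ P.SM) : 0 < P.weight I := by
  rw [weight, if_pos h]
  exact Real.exp_pos _

theorem mass_pos {A : PForm α} {I : Finset α} (h : I ∈ P.SM) (hA : PForm.Sat I A) :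
    0 < P.mass A := by
  classical
  refine Finset.sum_pos' (fun J _ => ?_) ⟨I, P.mem_models.2 h, ?_⟩
  · split_ifs
    · exact P.weight_nonneg J
    · exact le_rfl
  · rw [if_pos hA]
    exact P.weight_pos h

end LPMLN

/-- If all models of a proposition have the same utility, this is the expected utility. -/
theorem expUtility_eq_of_forall {α : Type u} (P : LPMLN (UAtom α)) (A : PForm (UAtom α)) (w : ℝ)
    (h : ∀ I ∈ P.SM, PForm.Sat I A → utilityOf I = w) (hA : ∃ I ∈ P.SM, PForm.Sat I A) :
    expUtility P A = w := by
  classical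
  obtain ⟨I, hI, hIA⟩ := hA
  have hpos : P.probOf A ≠ 0 := by
    rw [LPMLN.probOf_eq]
    exact (div_pos (P.mass_pos hI hIA) ((P.mass_pos hI hIA).trans_le (P.mass_le A))).ne'
  have : expUtility P A = ∑ I ∈ P.models with PForm.Sat I A, w * (P.prob I / P.probOf A) := by
    refine Finset.sum_congr (by congr) fun I hI => ?_
    obtain ⟨hI, hIA⟩ := Finset.mem_filter.1 hI
    rw [h I (P.mem_models.1 hI) hIA, LPMLN.condProbInterp, if_pos hIA]
  rw [this, ← Finset.mul_sum, ← Finset.sum_div]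
  have h1 : ∑ I ∈ P.models with PForm.Sat I A, P.prob I = P.probOf A := by
    unfold LPMLN.probOf
    congr
  rw [h1, div_self hpos, mul_one]

namespace ActionDescription

variable {S : PBCSignature.{u}} (D : ActionDescription S) {m : ℕ}

theorem prog_false : D.prog m false = D.Dm m := rfl

theorem prog_true : D.prog m true = D.Tr m := rfl

/-! ### States and transitions -/

theorem sat_flForm {X : Finset S.TAtom} {i : ℕ} {s : S.FlAssign} (h : AgreesFl X i s)
    (s' : S.FlAssign) : PForm.Sat X (flForm i s') ↔ s = s' := by
  rw [flForm, sat_bigAnd, funext_iff]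
  exact forall_congr' fun c => h c _

theorem sat_actForm {X : Finset S.TAtom} {i : ℕ} {e : S.ActAssign} (h : AgreesAct X i e)
    (e' : S.ActAssign) : PForm.Sat X (actForm i e') ↔ e = e' := by
  rw [actForm, sat_bigAnd, funext_iff]
  exact forall_congr' fun c => h c _

theorem Valid.stateCond {d : Run S m} (hv : D.Valid d) (i : Fin (m + 1)) :
    D.StateCond (d.fl i) := by
  induction i using Fin.cases with
  | zero => exact hv.state
  | succ i => exact (hv.step i).stateCond

theorem isState_iff {s : S.FlAssign} : D.IsState s ↔ D.StateCond s := by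
  constructor
  · rintro ⟨X, hX, hs⟩
    obtain ⟨d, -, hv, rfl⟩ := D.mem_SM_prog_iff.1 (D.prog_false ▸ hX)
    rw [hs.eq ((D.agrees_interp d).fl 0)]
    exact hv.state
  · intro h
    let d : Run S 0 := ⟨fun _ => s, fun i => i.elim0, fun i => i.elim0, none⟩
    refine ⟨D.interp d, D.interp_mem_SM_of_valid (b := false) rfl ⟨h, fun i => i.elim0, ?_⟩,
      (D.agrees_interp d).fl 0⟩
    rintro _ ⟨⟩

/-- The run with the single step from `s` to `s'`. -/
def stepRun (s : S.FlAssign) (e : S.ActAssign) (f : S.PfAssign) (s' : S.FlAssign) : Run S 1 :=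
  ⟨![s, s'], fun _ => e, fun _ => f, none⟩

theorem stepRun_mem_SM {s : S.FlAssign} {e : S.ActAssign} {f : S.PfAssign} {s' : S.FlAssign}
    (h : D.StateCond s) (h' : D.StepCond s e f s') :
    D.interp (stepRun s e f s') ∈ (D.Dm 1).SM := by
  refine D.interp_mem_SM_of_valid (b := false) rfl ⟨h, fun i => ?_, ?_⟩
  · obtain rfl := Subsingleton.elim i 0
    exact h'
  · rintro _ ⟨⟩

theorem isPfTransition_iff {s : S.FlAssign} {e : S.ActAssign} {s' : S.FlAssign}
    {f : S.PfAssign} : D.IsPfTransition s e s' f ↔ D.StateCond s ∧ D.StepCond s e f s' := by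
  constructor
  · rintro ⟨X, hX, hs, he, hs', hf⟩
    obtain ⟨d, -, hv, rfl⟩ := D.mem_SM_prog_iff.1 (D.prog_false ▸ hX)
    have hd := D.agrees_interp d
    rw [hs.eq (hd.fl 0), he.eq (hd.act 0), hs'.eq (hd.fl 1), hf.eq (hd.pf 0)]
    exact ⟨hv.state, hv.step 0⟩
  · rintro ⟨h, h'⟩
    have hd := D.agrees_interp (stepRun s e f s')
    exact ⟨_, D.stepRun_mem_SM h h', hd.fl 0, hd.act 0, hd.fl 1, hd.pf 0⟩

theorem atMostOneAction_of_isActionInterp (h1 : D.NoConcurrency) {a : S.ActAssign}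
    (ha : D.IsActionInterp a) : AtMostOneAction a := by
  obtain ⟨X, hX, ha⟩ := ha
  obtain ⟨d, -, hv, rfl⟩ := D.mem_SM_prog_iff.1 (D.prog_false ▸ hX)
  have hd := D.agrees_interp d
  exact h1 (d.fl 0) a (d.fl 1) ⟨_, hX, hd.fl 0, ha, hd.fl 1⟩

/-- At each state, an executable action and values of the pf constants determine the next
state. -/
theorem existsUnique_stepCond (h1 : D.NoConcurrency) (h2 : D.TransitionsControlled) (s : D.States)
    (a : D.Actions) (f : S.PfAssign) : ∃! s' : D.States, D.StepCond s.1 a.1 f s'.1 := by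
  obtain ⟨s', ⟨hs', ht⟩, hu⟩ := h2 s.1 s.2 a.1 (D.atMostOneAction_of_isActionInterp h1 a.2) f
  refine ⟨⟨s', hs'⟩, (D.isPfTransition_iff.1 ht).2, fun t ht => Subtype.ext (hu _ ⟨t.2, ?_⟩)⟩
  exact D.isPfTransition_iff.2 ⟨D.isState_iff.1 s.2, ht⟩

/-! ### Utilities of runs -/

open Classical in
/-- The utility paid at the transition from `s` to `s'` by `e`. -/
noncomputable def stepUtility (s : S.FlAssign) (e : S.ActAssign) (s' : S.FlAssign) : ℝ :=
  ∑ k, if D.Pays s e s' k then (D.utilityLaws.get k).v else 0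

theorem utilityOf_interp (d : Run S m) : utilityOf (D.interp d) =
    ∑ i : Fin m, D.stepUtility (d.fl i.castSucc) (d.act i) (d.fl i.succ) := by
  classical
  have hsub : ((Finset.univ : Finset (Fin m × Fin D.utilityLaws.length)).filter fun p =>
      D.Pays (d.fl p.1.castSucc) (d.act p.1) (d.fl p.1.succ) p.2).image
      (fun p => D.utilityAtom p.1 p.2) ⊆ D.interp d := by
    intro a ha
    obtain ⟨p, hp, rfl⟩ := Finset.mem_image.1 ha
    exact (D.utilityAtom_mem_interp d p.1 p.2).2 (Finset.mem_filter.1 hp).2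
  rw [utilityOf, ← Finset.sum_subset hsub, Finset.sum_image, Finset.sum_filter,
    Fintype.sum_prod_type]
  · rfl
  · intro p _ q _ h
    obtain ⟨h1, h2⟩ := D.utilityAtom_inj.1 h
    exact Prod.ext (Fin.ext h1) h2
  · intro a ha hna
    rw [mem_interp] at ha
    obtain ⟨i, c, rfl⟩ | ⟨i, c, rfl⟩ | ⟨i, c, rfl⟩ | ⟨g, hg, c, rfl⟩ | ⟨i, k, hk, rfl⟩ := ha
    · rfl
    · rfl
    · rfl
    · rfl
    · exact absurd (Finset.mem_image.2 ⟨(i, k), Finset.mem_filter.2 ⟨Finset.mem_univ _, hk⟩, rfl⟩)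
        hna

theorem sat_statesForm {X : Finset S.TAtom} {d : Run S m} (h : Agrees X d)
    (s : Fin (m + 1) → D.States) :
    PForm.Sat X (D.statesForm s) ↔ ∀ i, d.fl i = (s i).1 := by
  rw [statesForm, sat_bigAnd]
  exact forall_congr' fun i => sat_flForm (h.fl i) _

theorem sat_historyForm {X : Finset S.TAtom} {d : Run S m} (h : Agrees X d)
    (s : Fin (m + 1) → D.States) (a : Fin m → D.Actions) :
    PForm.Sat X (D.historyForm s a) ↔ (∀ i, d.fl i = (s i).1) ∧ ∀ i, d.act i = (a i).1 := by
  rw [historyForm, PForm.Sat, D.sat_statesForm h, sat_bigAnd]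
  exact and_congr_right fun _ => forall_congr' fun i => sat_actForm (h.act i) _

/-- The reward of a possible transition is the utility paid at it. -/
theorem toMDP_R_eq {s s' : D.States} {a : D.Actions} {f : S.PfAssign}
    (h : D.StepCond s.1 a.1 f s'.1) : D.toMDP.R s a s' = D.stepUtility s.1 a.1 s'.1 := by
  refine expUtility_eq_of_forall _ _ _ (fun X hX hA => ?_)
    ⟨_, D.stepRun_mem_SM (D.isState_iff.1 s.2) h, ?_⟩
  · obtain ⟨d, -, hv, rfl⟩ := D.mem_SM_prog_iff.1 (D.prog_false ▸ hX)
    have hd := D.agrees_interp d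
    obtain ⟨⟨h0, ha⟩, h1⟩ := hA
    rw [← (sat_flForm (hd.fl 0) _).1 h0, ← (sat_actForm (hd.act 0) _).1 ha,
      ← (sat_flForm (hd.fl 1) _).1 h1, utilityOf_interp]
    exact Fin.sum_univ_one _
  · have hd := D.agrees_interp (stepRun s.1 a.1 f s'.1)
    exact ⟨⟨(sat_flForm (hd.fl 0) _).2 rfl, (sat_actForm (hd.act 0) _).2 rfl⟩,
      (sat_flForm (hd.fl 1) _).2 rfl⟩

/-- The expected total reward of a possible history is the sum of the rewards in `M(D)`. -/
theorem totalReward_eq (s : Fin (m + 1) → D.States) (a : Fin m → D.Actions)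
    (h : ∃ X ∈ (D.Tr m).SM, PForm.Sat X (D.historyForm s a)) :
    D.totalReward s a = D.toMDP.totalReward s a := by
  have hM : D.toMDP.totalReward s a =
      ∑ i : Fin m, D.stepUtility (s i.castSucc).1 (a i).1 (s i.succ).1 := by
    obtain ⟨X, hX, hA⟩ := h
    obtain ⟨d, -, hv, rfl⟩ := D.mem_SM_prog_iff.1 (D.prog_true ▸ hX)
    obtain ⟨hfl, hact⟩ := (D.sat_historyForm (D.agrees_interp d) s a).1 hA
    refine Finset.sum_congr rfl fun i _ => D.toMDP_R_eq (f := d.pf i) ?_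
    rw [← hfl, ← hfl, ← hact]
    exact hv.step i
  rw [hM]
  refine expUtility_eq_of_forall _ _ _ (fun X hX hA => ?_) h
  obtain ⟨d, -, hv, rfl⟩ := D.mem_SM_prog_iff.1 (D.prog_true ▸ hX)
  obtain ⟨hfl, hact⟩ := (D.sat_historyForm (D.agrees_interp d) s a).1 hA
  simp only [utilityOf_interp, hfl, hact]

end ActionDescription

/-! ### Weights of runs -/

namespace ActionDescription

variable {S : PBCSignature.{u}} (D : ActionDescription S) {m : ℕ}

/-- The probability of values of the pf constants at one time point. -/
noncomputable def pfWeight (f : S.PfAssign) : ℝ := ∏ c, D.pfProb c (f c)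

/-- The probability of values of the initpf constants. -/
noncomputable def initWeight (g : S.InitAssign) : ℝ := ∏ c, D.initProb c (g c)

open Classical in
theorem sum_pfWeight : ∑ f : S.PfAssign, D.pfWeight f = 1 := by
  have h := Finset.prod_univ_sum (fun c : S.Pf => (Finset.univ : Finset (S.pfDom c)))
    (fun c v => D.pfProb c v)
  rw [Fintype.piFinset_univ] at h
  simp only [pfWeight, ← h, D.pfProb_sum, Finset.prod_const_one]

theorem initWeight_pos (g : S.InitAssign) : 0 < D.initWeight g :=
  Finset.prod_pos fun c _ => D.initProb_pos c _

/-- The rules that contribute to the weight of a run are the soft facts for its pf and initpf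
values. -/
theorem sum_weight_val {b : Bool} (d : Run S m) (hb : d.init.isSome = b)
    [DecidablePred fun r : WRule S.TAtom => PForm.Sat (D.interp d) r.rule.toForm] :
    ∑ r ∈ D.prog m b with PForm.Sat (D.interp d) r.rule.toForm, r.weight.val =
      ∑ i : Fin m, ∑ c, Real.log (D.pfProb c (d.pf i c)) +
        d.init.elim 0 fun g => ∑ c, Real.log (D.initProb c (g c)) := by
  classical
  have hd := D.agrees_interp d
  -- The rules that contribute are the soft facts that hold.
  let T₁ : Finset (WRule S.TAtom) := (Finset.univ : Finset (Fin m × S.Pf)).image fun p =>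
    softFact (Real.log (D.pfProb p.2 (d.pf p.1 p.2))) (stamp p.1 (.pf p.2 (d.pf p.1 p.2)))
  let T₂ : Finset (WRule S.TAtom) := d.init.elim ∅ fun g => (Finset.univ : Finset S.InitPf).image
    fun c => softFact (Real.log (D.initProb c (g c))) (stamp 0 (.initpf c (g c)))
  have hT₁ : ∀ r, r ∈ T₁ ↔ ∃ (i : Fin m) (c : S.Pf),
      softFact (Real.log (D.pfProb c (d.pf i c))) (stamp i (.pf c (d.pf i c))) = r := by
    simp [T₁]
  have hT₂ : ∀ r, r ∈ T₂ ↔ ∃ g ∈ d.init, ∃ c : S.InitPf,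
      softFact (Real.log (D.initProb c (g c))) (stamp 0 (.initpf c (g c))) = r := by
    intro r
    simp only [T₂]
    cases d.init <;> simp
  have hsoft : ∀ {w w' : ℝ} {a a' : S.TAtom}, softFact w a = softFact w' a' → a = a' := by
    intro w w' a a' h
    simp only [softFact, WRule.mk.injEq, LPRule.mk.injEq, PForm.atom.injEq] at h
    exact h.2.1
  have hall := (D.forall_mem_prog m b fun r => r ∈ D.prog m b).1 fun r hr => hr
  rw [forall_mem_Dm, forall_mem_Dinit] at hall
  obtain ⟨⟨-, -, -, -, hpf, -⟩, hinit⟩ := hall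
  have hsub : T₁ ∪ T₂ ⊆ (D.prog m b).filter
      fun r => PForm.Sat (D.interp d) r.rule.toForm := by
    intro r hr
    rw [Finset.mem_filter]
    rcases Finset.mem_union.1 hr with hr | hr
    · obtain ⟨i, c, rfl⟩ := (hT₁ r).1 hr
      exact ⟨hpf i c _, fun _ => (hd.pf i c _).2 rfl⟩
    · obtain ⟨g, hg, c, rfl⟩ := (hT₂ r).1 hr
      have hbt : b = true := hb ▸ Option.isSome_iff_exists.2 ⟨g, hg⟩
      exact ⟨(hinit hbt).2.1 c _, fun _ => (hd.init g hg c _).2 rfl⟩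
  have hdisj : Disjoint T₁ T₂ := by
    rw [Finset.disjoint_left]
    intro r h₁ h₂
    obtain ⟨i, c, rfl⟩ := (hT₁ r).1 h₁
    obtain ⟨g, hg, c', h⟩ := (hT₂ _).1 h₂
    exact nomatch (stamp_inj.1 (hsoft h)).2
  rw [← Finset.sum_subset hsub, Finset.sum_union hdisj]
  · congr 1
    · rw [Finset.sum_image, Fintype.sum_prod_type]
      · rfl
      · rintro ⟨i, c⟩ _ ⟨j, c'⟩ _ h
        obtain ⟨h1, h2⟩ := stamp_inj.1 (hsoft h)
        cases Fin.ext h1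
        injection h2 with h2
        subst h2
        rfl
    · simp only [T₂]
      cases d.init with
      | none => rfl
      | some g =>
        simp only [Option.elim]
        rw [Finset.sum_image]
        · rfl
        · intro c _ c' _ h
          injection (stamp_inj.1 (hsoft h)).2
  · have key : ∀ r ∈ D.prog m b, PForm.Sat (D.interp d) r.rule.toForm → r ∉ T₁ ∪ T₂ →
        r.weight.val = 0 := by
      rw [forall_mem_prog, forall_mem_Dm, forall_mem_Dinit]
      have hval : ∀ r : WRule S.TAtom, r.weight = .hard → r.weight.val = 0 := by
        intro r hr
        rw [hr]
        rfl
      refine ⟨⟨fun _ _ _ _ _ => rfl, fun _ _ _ _ _ => rfl, fun _ _ _ _ _ => rfl,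
        fun _ _ _ _ _ => rfl, fun i c v h hn => ?_,
        fun _ _ r hr _ _ => hval r (weight_valueConstraints _ r hr),
        fun _ _ r hr _ _ => hval r (weight_valueConstraints _ r hr),
        fun _ _ r hr _ _ => hval r (weight_valueConstraints _ r hr), fun _ _ _ _ => rfl⟩,
        fun hbt => ⟨fun _ _ _ _ => rfl, fun c v h hn => ?_,
        fun _ r hr _ _ => hval r (weight_valueConstraints _ r hr),
        fun _ r hr _ _ => hval r (weight_valueConstraints _ r hr)⟩⟩
      · have hv := (hd.pf i c v).1 (h id)
        subst hv
        exact absurd (Finset.mem_union_left _ ((hT₁ _).2 ⟨i, c, rfl⟩)) hn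
      · obtain ⟨g, hg⟩ := Option.isSome_iff_exists.1 (hb.trans hbt)
        have hv := (hd.init g hg c v).1 (h id)
        subst hv
        exact absurd (Finset.mem_union_right _ ((hT₂ _).2 ⟨g, hg, c, rfl⟩)) hn
    intro r hr
    obtain ⟨hr, hs⟩ := Finset.mem_filter.1 hr
    exact key r hr hs

theorem weight_interp {b : Bool} {d : Run S m} (hb : d.init.isSome = b) (hv : D.Valid d) :
    (D.prog m b).weight (D.interp d) =
      (∏ i, D.pfWeight (d.pf i)) * d.init.elim 1 D.initWeight := by
  classical
  rw [LPMLN.weight, if_pos (D.interp_mem_SM_of_valid hb hv), D.sum_weight_val d hb, Real.exp_add,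
    Real.exp_sum]
  congr 1
  · refine Finset.prod_congr rfl fun i _ => ?_
    rw [Real.exp_sum]
    exact Finset.prod_congr rfl fun c _ => Real.exp_log (D.pfProb_pos c _)
  · cases d.init with
    | none => exact Real.exp_zero
    | some g =>
      simp only [Option.elim, Real.exp_sum]
      exact Finset.prod_congr rfl fun c _ => Real.exp_log (D.initProb_pos c _)

/-! ### Masses as sums over state sequences -/

open Classical in
/-- The probability, over the values of the pf constants, that `e` leads from `s` to `s'`. -/
noncomputable def kernel (s : S.FlAssign) (e : S.ActAssign) (s' : S.FlAssign) : ℝ :=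
  ∑ f : S.PfAssign, if D.StepCond s e f s' then D.pfWeight f else 0

open Classical in
/-- The weight of an initial state: in `Tr(D, m)` the probability of the values of the initpf
constants that are compatible with it, and `1` in `D_m`. -/
noncomputable def startWeight (b : Bool) (s : S.FlAssign) : ℝ :=
  ∑ g : Option S.InitAssign, if g.isSome = b ∧ ∀ g₀ ∈ g, D.InitCond s g₀ then
    g.elim 1 D.initWeight else 0

/-- The run with the given values whose fluents describe the states `s`. -/
def runOf {D : ActionDescription S} (s : Fin (m + 1) → D.States) (e : Fin m → S.ActAssign)
    (f : Fin m → S.PfAssign) (g : Option S.InitAssign) : Run S m :=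
  ⟨fun i => (s i).1, e, f, g⟩

theorem valid_runOf_iff (s : Fin (m + 1) → D.States) (e : Fin m → S.ActAssign)
    (f : Fin m → S.PfAssign) (g : Option S.InitAssign) :
    D.Valid (runOf s e f g) ↔
      (∀ i, D.StepCond (s i.castSucc).1 (e i) (f i) (s i.succ).1) ∧
        ∀ g₀ ∈ g, D.InitCond (s 0).1 g₀ :=
  ⟨fun h => ⟨h.step, h.init⟩, fun h => ⟨D.isState_iff.1 (s 0).2, h.1, h.2⟩⟩

open Classical in
/-- Sums over the stable models are sums over the valid runs, since distinct runs determine distinct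
interpretations. -/
theorem sum_models {b : Bool} (φ : Finset S.TAtom → ℝ) :
    ∑ X ∈ (D.prog m b).models, φ X =
      ∑ s : Fin (m + 1) → D.States, ∑ e : Fin m → S.ActAssign, ∑ f : Fin m → S.PfAssign,
        ∑ g : Option S.InitAssign,
          if g.isSome = b ∧ D.Valid (runOf s e f g) then φ (D.interp (runOf s e f g)) else 0 := by
  let run : ((Fin (m + 1) → D.States) × (Fin m → S.ActAssign) × (Fin m → S.PfAssign) ×
      Option S.InitAssign) → Run S m := fun p => runOf p.1 p.2.1 p.2.2.1 p.2.2.2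
  have himg : (D.prog m b).models = (Finset.univ.filter fun p =>
      p.2.2.2.isSome = b ∧ D.Valid (run p)).image fun p => D.interp (run p) := by
    ext X
    rw [LPMLN.mem_models, mem_SM_prog_iff]
    simp only [Finset.mem_image, Finset.mem_filter, Finset.mem_univ, true_and]
    constructor
    · rintro ⟨d, hb, hv, rfl⟩
      exact ⟨⟨fun i => ⟨d.fl i, D.isState_iff.2 (hv.stateCond D i)⟩, d.act, d.pf, d.init⟩,
        ⟨hb, hv⟩, rfl⟩
    · rintro ⟨p, ⟨hb, hv⟩, rfl⟩
      exact ⟨run p, hb, hv, rfl⟩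
  rw [himg, Finset.sum_image, Finset.sum_filter]
  · simp only [Fintype.sum_prod_type, run]
  · rintro ⟨s, e, f, g⟩ hp ⟨s', e', f', g'⟩ hp' h
    have hd := D.agrees_interp (runOf s e f g)
    have hd' := D.agrees_interp (runOf s' e' f' g')
    rw [show D.interp (runOf s e f g) = D.interp (runOf s' e' f' g') from h] at hd
    have hs : s = s' := funext fun i => Subtype.ext ((hd.fl i).eq (hd'.fl i))
    have he : e = e' := funext fun i => (hd.act i).eq (hd'.act i)
    have hf : f = f' := funext fun i => (hd.pf i).eq (hd'.pf i)
    have hb : g.isSome = b := (Finset.mem_filter.1 hp).2.1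
    have hb' : g'.isSome = b := (Finset.mem_filter.1 hp').2.1
    have hg : g = g' := by
      cases g with
      | none =>
        cases g' with
        | none => rfl
        | some _ => exact nomatch hb.trans hb'.symm
      | some g₀ =>
        cases g' with
        | none => exact nomatch hb.trans hb'.symm
        | some g₁ => exact congrArg some ((hd.init g₀ rfl).eq (hd'.init g₁ rfl))
    rw [hs, he, hf, hg]

open Classical in
theorem sum_prod_pf (s : Fin (m + 1) → D.States) (e : Fin m → S.ActAssign) :
    (∑ f : Fin m → S.PfAssign,
      if ∀ i, D.StepCond (s i.castSucc).1 (e i) (f i) (s i.succ).1 then ∏ i, D.pfWeight (f i)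
        else 0) =
      ∏ i, D.kernel (s i.castSucc).1 (e i) (s i.succ).1 := by
  have h := Finset.prod_univ_sum (fun _ : Fin m => (Finset.univ : Finset S.PfAssign))
    (fun i f => if D.StepCond (s i.castSucc).1 (e i) f (s i.succ).1 then D.pfWeight f else 0)
  rw [Fintype.piFinset_univ] at h
  refine Eq.trans ?_ h.symm
  refine Finset.sum_congr rfl fun f _ => ?_
  rw [Finset.prod_ite_zero]
  simp

open Classical in
/-- The mass of a proposition that constrains the states and makes the actions a function of
them. The values of the pf constants at different times and of the initpf constants are
independent, so that the weight of a state sequence is a product over its steps. -/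
theorem mass_eq {b : Bool} (A : PForm S.TAtom) (C : (Fin (m + 1) → D.States) → Prop)
    (a : (Fin (m + 1) → D.States) → Fin m → S.ActAssign)
    (hA : ∀ s e f g, PForm.Sat (D.interp (runOf s e f g)) A ↔ C s ∧ e = a s) :
    (D.prog m b).mass A = ∑ s : Fin (m + 1) → D.States, if C s then
      D.startWeight b (s 0).1 * ∏ i, D.kernel (s i.castSucc).1 (a s i) (s i.succ).1 else 0 := by
  unfold LPMLN.mass
  rw [sum_models]
  refine Finset.sum_congr rfl fun s _ => ?_
  rw [Finset.sum_eq_single (a s)]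
  · split_ifs with hC
    · rw [mul_comm, ← sum_prod_pf, startWeight, Finset.sum_mul_sum]
      refine Finset.sum_congr rfl fun f _ => Finset.sum_congr rfl fun g _ => ?_
      rw [if_pos ((hA _ _ _ _).2 ⟨hC, rfl⟩)]
      by_cases hv : g.isSome = b ∧ D.Valid (runOf s (a s) f g)
      · have hv' := (D.valid_runOf_iff _ _ _ _).1 hv.2
        rw [if_pos hv, if_pos hv'.1, if_pos ⟨hv.1, hv'.2⟩, D.weight_interp hv.1 hv.2]
        rfl
      · rw [if_neg hv]
        rw [valid_runOf_iff] at hv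
        split_ifs with h1 h2
        · exact absurd ⟨h2.1, h1, h2.2⟩ hv
        all_goals simp
    · refine Finset.sum_eq_zero fun f _ => Finset.sum_eq_zero fun g _ => ?_
      rw [if_neg (fun h => hC ((hA _ _ _ _).1 h).1), ite_self]
  · intro e _ he
    refine Finset.sum_eq_zero fun f _ => Finset.sum_eq_zero fun g _ => ?_
    rw [if_neg (fun h => he ((hA _ _ _ _).1 h).2), ite_self]
  · exact fun h => absurd (Finset.mem_univ _) h

end ActionDescription

/-- The weights of the paths of a Markov chain from a fixed state sum to `1`. -/
theorem sum_prod_eq_one_of_sum_eq_one {σ : Type*} [Fintype σ] [DecidableEq σ] {m : ℕ}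
    (k : Fin m → σ → σ → ℝ) (hk : ∀ i s, ∑ s', k i s s' = 1) (s₀ : σ) :
    (∑ s : Fin (m + 1) → σ, if s 0 = s₀ then ∏ i : Fin m, k i (s i.castSucc) (s i.succ) else 0) =
      1 := by
  induction m generalizing s₀ with
  | zero =>
    rw [Finset.sum_eq_single fun _ => s₀]
    · simp
    · intro s _ hs
      exact if_neg fun h => hs (funext fun i => by rw [← h, Fin.fin_one_eq_zero i])
    · exact fun h => absurd (Finset.mem_univ _) h
  | succ m ih =>
    rw [← (Fin.consEquiv fun _ : Fin (m + 2) => σ).sum_comp, Fintype.sum_prod_type,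
      Finset.sum_eq_single s₀]
    · -- Split off the first transition, to the state `t 0`.
      have hstep : ∀ t : Fin (m + 1) → σ,
          (if (Fin.consEquiv fun _ : Fin (m + 2) => σ) (s₀, t) 0 = s₀ then
            ∏ i : Fin (m + 1), k i ((Fin.consEquiv fun _ : Fin (m + 2) => σ) (s₀, t) i.castSucc)
              ((Fin.consEquiv fun _ : Fin (m + 2) => σ) (s₀, t) i.succ) else 0) =
          ∑ s₁, k 0 s₀ s₁ * if t 0 = s₁ then
            ∏ i : Fin m, k i.succ (t i.castSucc) (t i.succ) else 0 := by
        intro t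
        simp [Fin.consEquiv, Fin.prod_univ_succ]
      simp only [hstep]
      rw [Finset.sum_comm]
      simp only [← Finset.mul_sum, ih (fun i => k i.succ) (fun i => hk i.succ), mul_one]
      exact hk 0 s₀
    · intro s _ hs
      exact Finset.sum_eq_zero fun t _ => if_neg hs
    · exact fun h => absurd (Finset.mem_univ _) h

namespace ActionDescription

variable {S : PBCSignature.{u}} (D : ActionDescription S) {m : ℕ}

/-! ### Transition and history probabilities -/

/-- Transition probabilities sum to one: each choice of pf values counts for exactly one successor
state. -/
theorem sum_kernel (h1 : D.NoConcurrency) (h2 : D.TransitionsControlled) (s : D.States)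
    (a : D.Actions) : ∑ s' : D.States, D.kernel s.1 a.1 s'.1 = 1 := by
  classical
  unfold kernel
  rw [Finset.sum_comm, ← D.sum_pfWeight]
  refine Finset.sum_congr (by congr) fun f _ => ?_
  obtain ⟨t, ht, hu⟩ := D.existsUnique_stepCond h1 h2 s a f
  rw [Finset.sum_eq_single t, if_pos ht]
  · exact fun t' _ hne => if_neg fun h => hne (hu t' h)
  · exact fun h => absurd (Finset.mem_univ _) h

theorem startWeight_false (s : S.FlAssign) : D.startWeight false s = 1 := by
  classical
  rw [startWeight, Finset.sum_eq_single none]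
  · simp
  · rintro (_ | g) _ hg
    · exact absurd rfl hg
    · simp
  · exact fun h => absurd (Finset.mem_univ _) h

theorem startWeight_pos {s : S.FlAssign} (hs : D.ConsistentInit s) :
    0 < D.startWeight true s := by
  classical
  obtain ⟨X, hX, hA⟩ := hs
  obtain ⟨d, hb, hv, rfl⟩ := D.mem_SM_prog_iff.1 (D.prog_true ▸ hX)
  obtain rfl := (sat_flForm ((D.agrees_interp d).fl 0) s).1 hA
  obtain ⟨g, hg⟩ := Option.isSome_iff_exists.1 hb
  refine Finset.sum_pos' (fun g _ => ?_) ⟨some g, Finset.mem_univ _, ?_⟩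
  · split_ifs
    · cases g with
      | none => exact zero_le_one
      | some g => exact (D.initWeight_pos g).le
    · exact le_rfl
  · rw [if_pos ⟨rfl, by rintro _ ⟨⟩; exact hv.init g hg⟩]
    exact D.initWeight_pos g

/-- The mass of the runs from `s₀` whose actions follow a policy, as a multiple of the weight of
`s₀`. -/
theorem mass_start (h1 : D.NoConcurrency) (h2 : D.TransitionsControlled) {b : Bool}
    (A : PForm S.TAtom) (s₀ : D.States) (π : D.Policy m)
    (hA : ∀ s e f g, PForm.Sat (D.interp (runOf s e f g)) A ↔
      s 0 = s₀ ∧ e = fun i => (π (s i.castSucc) i).1) :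
    (D.prog m b).mass A = D.startWeight b s₀.1 := by
  classical
  rw [D.mass_eq A (fun s => s 0 = s₀) (fun s i => (π (s i.castSucc) i).1) hA,
    ← mul_one (D.startWeight b s₀.1),
    ← sum_prod_eq_one_of_sum_eq_one (fun (i : Fin m) s s' => D.kernel s.1 (π s i).1 s'.1)
      (fun i s => D.sum_kernel h1 h2 s (π s i)) s₀, Finset.mul_sum]
  refine Finset.sum_congr rfl fun s _ => ?_
  split_ifs with h
  · rw [h]
  · rw [mul_zero]

theorem mass_states {b : Bool} (A : PForm S.TAtom) (s : Fin (m + 1) → D.States) (π : D.Policy m)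
    (hA : ∀ s' e f g, PForm.Sat (D.interp (runOf s' e f g)) A ↔
      s' = s ∧ e = fun i => (π (s' i.castSucc) i).1) :
    (D.prog m b).mass A = D.startWeight b (s 0).1 *
      ∏ i, D.kernel (s i.castSucc).1 (π (s i.castSucc) i).1 (s i.succ).1 := by
  classical
  rw [D.mass_eq A (fun s' => s' = s) (fun s i => (π (s i.castSucc) i).1) hA,
    Finset.sum_eq_single s, if_pos rfl]
  · exact fun s' _ h => if_neg h
  · exact fun h => absurd (Finset.mem_univ _) h

theorem sat_flForm_runOf (s : Fin (m + 1) → D.States) (e : Fin m → S.ActAssign)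
    (f : Fin m → S.PfAssign) (g : Option S.InitAssign) (i : Fin (m + 1)) (t : D.States) :
    PForm.Sat (D.interp (runOf s e f g)) (flForm i t.1) ↔ s i = t :=
  (sat_flForm ((D.agrees_interp _).fl i) _).trans Subtype.ext_iff.symm

theorem sat_actForm_runOf (s : Fin (m + 1) → D.States) (e : Fin m → S.ActAssign)
    (f : Fin m → S.PfAssign) (g : Option S.InitAssign) (i : Fin m) (a : S.ActAssign) :
    PForm.Sat (D.interp (runOf s e f g)) (actForm i a) ↔ e i = a :=
  sat_actForm ((D.agrees_interp _).act i) _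

theorem sat_statesForm_runOf (s : Fin (m + 1) → D.States) (e : Fin m → S.ActAssign)
    (f : Fin m → S.PfAssign) (g : Option S.InitAssign) (t : Fin (m + 1) → D.States) :
    PForm.Sat (D.interp (runOf s e f g)) (D.statesForm t) ↔ s = t := by
  rw [D.sat_statesForm (D.agrees_interp _), funext_iff]
  exact forall_congr' fun i => Subtype.ext_iff.symm

theorem sat_policyForm_runOf (s : Fin (m + 1) → D.States) (e : Fin m → S.ActAssign)
    (f : Fin m → S.PfAssign) (g : Option S.InitAssign) (π : D.Policy m) :
    PForm.Sat (D.interp (runOf s e f g)) (D.policyForm π) ↔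
      e = fun i => (π (s i.castSucc) i).1 := by
  rw [policyForm, sat_bigAnd, funext_iff]
  simp only [PForm.Sat, sat_actForm_runOf]
  constructor
  · exact fun h i => h (s i.castSucc, i) ((D.sat_flForm_runOf s e f g i.castSucc _).2 rfl)
  · rintro h ⟨t, i⟩ ht
    rw [h i, (D.sat_flForm_runOf s e f g i.castSucc t).1 ht]

theorem toMDP_T_eq (h1 : D.NoConcurrency) (h2 : D.TransitionsControlled) (s : D.States)
    (a : D.Actions) (s' : D.States) : D.toMDP.T s a s' = D.kernel s.1 a.1 s'.1 := by
  have hden : (D.Dm 1).mass (.and (flForm 0 s.1) (actForm 0 a.1)) = 1 := by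
    rw [← D.startWeight_false s.1, ← prog_false]
    refine D.mass_start h1 h2 _ s (fun _ _ => a) fun t e f g => ?_
    refine and_congr (D.sat_flForm_runOf t e f g 0 s) ?_
    rw [funext_iff, Fin.forall_fin_one]
    exact D.sat_actForm_runOf t e f g 0 a.1
  have hnum : (D.Dm 1).mass (.and (flForm 1 s'.1) (.and (flForm 0 s.1) (actForm 0 a.1))) =
      D.kernel s.1 a.1 s'.1 := by
    have h := D.mass_states (b := false)
      (.and (flForm 1 s'.1) (.and (flForm 0 s.1) (actForm 0 a.1))) ![s, s'] (fun _ _ => a)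
      fun t e f g => ?_
    · rw [startWeight_false, one_mul, Fin.prod_univ_one] at h
      exact h
    · rw [funext_iff, Fin.forall_fin_two, funext_iff, Fin.forall_fin_one]
      have h₁ := D.sat_flForm_runOf t e f g 1 s'
      have h₀ := D.sat_flForm_runOf t e f g 0 s
      have hₐ := D.sat_actForm_runOf t e f g 0 a.1
      exact (and_congr h₁ (and_congr h₀ hₐ)).trans
        ⟨fun h => ⟨⟨h.2.1, h.1⟩, h.2.2⟩, fun h => ⟨h.1.2, h.1.1, h.2⟩⟩
  change (D.Dm 1).condProb _ _ = _
  rw [LPMLN.condProb_eq, hden, hnum, div_one]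

end ActionDescription

theorem mainTheorem2 {S : PBCSignature.{u}} (D : ActionDescription S)
    (h1 : D.NoConcurrency) (h2 : D.TransitionsControlled) (h3 : D.InitialStatesControlled)
    (m : ℕ) (π : D.Policy m) (s : Fin (m + 1) → D.States) (hs : D.ConsistentInit (s 0).1) :
    ((∃ X ∈ (D.Tr m).SM,
        PForm.Sat X (D.historyForm s fun i => π (s i.castSucc) i)) →
      D.totalReward s (fun i => π (s i.castSucc) i) =
        D.toMDP.totalReward s (fun i => π (s i.castSucc) i)) ∧
    (D.Tr m).condProb (D.statesForm s) (.and (flForm 0 (s 0).1) (D.policyForm π)) =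
      D.toMDP.historyProb s (fun i => π (s i.castSucc) i) := by
  refine ⟨D.totalReward_eq s _, ?_⟩
  have hden : (D.Tr m).mass (.and (flForm 0 (s 0).1) (D.policyForm π)) =
      D.startWeight true (s 0).1 := by
    rw [← ActionDescription.prog_true]
    refine D.mass_start h1 h2 _ (s 0) π fun t e f g => ?_
    exact and_congr (D.sat_flForm_runOf t e f g 0 _) (D.sat_policyForm_runOf t e f g π)
  have hnum : (D.Tr m).mass
      (.and (D.statesForm s) (.and (flForm 0 (s 0).1) (D.policyForm π))) =
      D.startWeight true (s 0).1 * ∏ i : Fin m, D.kernel (s i.castSucc).1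
        (π (s i.castSucc) i).1 (s i.succ).1 := by
    rw [← ActionDescription.prog_true]
    refine D.mass_states _ s π fun t e f g => ?_
    refine (and_congr (D.sat_statesForm_runOf t e f g s)
      (and_congr (D.sat_flForm_runOf t e f g 0 _) (D.sat_policyForm_runOf t e f g π))).trans ?_
    exact and_congr_right fun h => and_iff_right (congrFun h 0)
  rw [LPMLN.condProb_eq, hden, hnum, mul_div_cancel_left₀ _ (D.startWeight_pos hs).ne']
  exact Finset.prod_congr rfl fun i _ => (D.toMDP_T_eq h1 h2 _ _ _).symm
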